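/- **Asymptotic normality of split-and-average M-estimation (fixed $p$).** Setting. Let $Z$ be a random variable with values in a measurable space $\mathcal Z$, let $\Theta\subset\mathbb R^p$ be open and convex, and let $f:\mathcal Z\times\Theta\to[0,\infty)$ be a loss function with $f(\cdot,\theta)$ measurable for every $\theta\in\Theta$. Assume that the population risk $R(\theta)=\mathbb E[f(Z,\theta)]\in[0,\infty]$ has a unique minimizer $\theta^*$ over $\Theta$. Fix the number of machines $m\ge 1$ and the dimension $p$. For each $n$, let $N=mn$ i.i.d. copies of $Z$ be allocated at random (independently of the observations, possibly deterministically) among $m$ machines, each machine receiving $n$ of them. Let $\hat\theta^{(j)}_n\in\Theta$ be an M-estimator of machine $j$: a random vector that, for all large $n$, almost surely minimizes over $\Theta$ the empirical risk $\frac1n\sum_{i\in[j]}f(z_i,\theta)$, where $[j]$ is the set of indices of the observations held by machine $j$. Let $\bar\theta=\frac1m\sum_{j=1}^m\hat\theta^{(j)}_n$. Assumptions. 1. $\hat\theta^{(j)}_n\to\theta^*$ in probability as $n\to\infty$, for each machine $j$. 2. $R$ admits a second order Taylor expansion at $\theta^*$ with nonsingular symmetric Hessian $V_{\theta^*}$: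 for some $b\in\mathbb R^p$, $R(\theta^*+h)=R(\theta^*)+b'h+\tfrac12h'V_{\theta^*}h+o(\|h\|^2)$ as $h\to0$. 3. $f(Z,\cdot)$ is differentiable at $\theta^*$ with gradient $\nabla f(\theta^*)=\nabla f(Z,\theta^*)$, either almost surely or in probability; the latter means that $\big(f(Z,\theta^*+h)-f(Z,\theta^*)-h'\nabla f(\theta^*)\big)/\|h\|\to0$ in probability as $h\to0$, $h\ne0$. 4. There are a neighborhood $U\subset\Theta$ of $\theta^*$ and a measurable $M$ with $\mathbb E[M(Z)^2]<\infty$ such that, almost surely, $|f(Z,\theta_1)-f(Z,\theta_2)|\le M(Z)\|\theta_1-\theta_2\|$ for all $\theta_1,\theta_2\in U$. Conclusion. The matrix $\mathbb E[\nabla f(\theta^*)\nabla f(\theta^*)']$ exists (its entries are expectations of integrable variables), $V_{\theta^*}^{-1}\,\mathbb E[\nabla f(\theta^*)\nabla f(\theta^*)']\,V_{\theta^*}^{-1}$ is positive semidefinite, and, as $n\to\infty$ with $p$ and $m$ fixed, $$\sqrt N\,(\bar\theta-\theta^*)\ \longrightarrow\ \mathcal N\Big(0,\ V_{\theta^*}^{-1}\,\mathbb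 E\big[\nabla f(\theta^*)\,\nabla f(\theta^*)'\big]\,V_{\theta^*}^{-1}\Big)\quad\text{in distribution.}$$ -/

import Mathlib

open MeasureTheory ProbabilityTheory Filter Topology Asymptotics
open scoped ENNReal Matrix

noncomputable section

/-- The population risk `R(θ) = E[f(Z, θ)]` of a nonnegative loss `f`, where `Z` has law `μ`.
It takes values in `[0, ∞]`, so that a parameter of infinite risk is not given a junk value. -/
def populationRisk {𝒵 E : Type*} [MeasurableSpace 𝒵] (μ : Measure 𝒵) (f : 𝒵 → E → ℝ) (θ : E) :
    ℝ≥0∞ :=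
  ∫⁻ z, ENNReal.ofReal (f z θ) ∂μ

/-- The empirical risk `(1/n) ∑ᵢ f(xᵢ, θ)` of a parameter `θ` on the data set `x₁, …, xₙ`. -/
def empiricalRisk {𝒵 E : Type*} {n : ℕ} (f : 𝒵 → E → ℝ) (x : Fin n → 𝒵) (θ : E) : ℝ :=
  (1 / (n : ℝ)) * ∑ i, f (x i) θ

/-- `θ` is an M-estimate for the data set `x`: it minimizes the empirical risk over `Θ`. -/
def IsMEstimate {𝒵 E : Type*} {n : ℕ} (f : 𝒵 → E → ℝ) (Θ : Set E) (x : Fin n → 𝒵) (θ : E) :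
    Prop :=
  θ ∈ Θ ∧ IsMinOn (empiricalRisk f x) Θ θ

/-- `R` admits a second order Taylor expansion at `θ` with (symmetric) Hessian `V`:
`R(θ + h) = R(θ) + b'h + (1/2) h'Vh + o(‖h‖²)` as `h → 0`, for some vector `b`. -/
def HasSecondOrderTaylorAt {p : ℕ} (R : EuclideanSpace ℝ (Fin p) → ℝ)
    (V : Matrix (Fin p) (Fin p) ℝ) (θ : EuclideanSpace ℝ (Fin p)) : Prop :=
  V.IsSymm ∧ ∃ b : EuclideanSpace ℝ (Fin p),
    (fun h : EuclideanSpace ℝ (Fin p) =>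
      R (θ + h) - R θ - inner ℝ b h - (1 / 2) * (h.ofLp ⬝ᵥ (V *ᵥ h.ofLp)))
      =o[𝓝 0] (fun h => ‖h‖ ^ 2)

/-- `f(Z, ·)` is differentiable at `θ` in probability, with (random) gradient `g(Z)`:
`(f(Z, θ + h) - f(Z, θ) - g(Z)'h) / ‖h‖ → 0` in probability as `h → 0`, `h ≠ 0`. -/
def HasGradientInProbabilityAt {𝒵 E : Type*} [MeasurableSpace 𝒵] [NormedAddCommGroup E]
    [InnerProductSpace ℝ E] (μ : Measure 𝒵) (f : 𝒵 → E → ℝ) (g : 𝒵 → E) (θ : E) : Prop :=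
  TendstoInMeasure μ (fun (h : E) (z : 𝒵) => (f z (θ + h) - f z θ - inner ℝ (g z) h) / ‖h‖)
    (𝓝[≠] 0) (fun _ => 0)

/-- `f(Z, ·)` is Lipschitz near `θ`, with a Lipschitz coefficient `M(Z)` of finite second moment. -/
def IsLipschitzNear {𝒵 E : Type*} [MeasurableSpace 𝒵] [NormedAddCommGroup E]
    (μ : Measure 𝒵) (f : 𝒵 → E → ℝ) (θ : E) : Prop :=
  ∃ M : 𝒵 → ℝ, MemLp M 2 μ ∧ ∃ U ∈ 𝓝 θ, ∀ᵐ z ∂μ, ∀ θ₁ ∈ U, ∀ θ₂ ∈ U,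
    |f z θ₁ - f z θ₂| ≤ M z * ‖θ₁ - θ₂‖

/-- The matrix `E[g(Z) g(Z)']`, where `Z` has law `μ`. -/
def secondMomentMatrix {𝒵 : Type*} [MeasurableSpace 𝒵] {p : ℕ} (μ : Measure 𝒵)
    (g : 𝒵 → EuclideanSpace ℝ (Fin p)) : Matrix (Fin p) (Fin p) ℝ :=
  Matrix.of fun a b => ∫ z, g z a * g z b ∂μ

/-- The average `(1/m) ∑ⱼ θⱼ` of the `m` machine-wise estimates. -/
def machineAverage {E : Type*} [AddCommGroup E] [Module ℝ E] {m : ℕ} (θ : Fin m → E) : E :=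
  (1 / (m : ℝ)) • ∑ j, θ j

end

/-!
# Asymptotic normality of split-and-average M-estimation

Write `φ(z, h) = f(z, θ* + h) - f(z, θ*) - g(z)'h` for the first order remainder of the loss and
`Gₙ ψ = n^{-1/2} ∑ᵢ (ψ(zᵢ) - E ψ)` for the empirical process. Summing the losses over a sample of
size `n` and expanding the population risk, with `k = √n h`,

  `∑ᵢ f(zᵢ, θ* + h) - ∑ᵢ f(zᵢ, θ*) = ½ k'Vk + k'S + √n Gₙ φ(·, h) + n o(‖h‖²)`,

where `S = n^{-1/2} ∑ᵢ g(zᵢ)` (`sum_loss_sub_eq`). The analytic core is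
`stochastic_differentiability`: for every `ε > 0`, with probability close to one,
`|Gₙ φ(·, h)| ≤ ε (√n ‖h‖² + 1/√n)` uniformly over a neighborhood of `h = 0`. On this event the
perturbation of the quadratic at `k` is at most a small multiple of `‖k‖² + 1`, so comparing the
estimator with the exact minimizer `-V⁻¹S` of the quadratic gives at once the `√n`-rate and the
linearization `√n (θ̂ - θ*) = -V⁻¹S + o_P(1)`
(`norm_sub_sq_le_of_perturbed_quadratic_le`, `tendstoInMeasure_mEstimator_linearization`).

The uniform bound holds because, after truncating the Lipschitz coefficient at `√n`, the increments
of `h ↦ Gₙ φ(·, h)` have exponential tails at scale `‖h - h'‖` (`empFluct_exp_tail`), so that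
chaining over dyadic grids reduces the supremum over a shell `‖h‖ ≈ 2^j/√n` to finitely many points,
uniformly in `j` and `n` (`exists_finset_chaining`). At these points Chebyshev's inequality
suffices, as `E φ(Z, h)² = o(‖h‖²)` by dominated convergence, and the bounds are summable over the
shells (`empFluct_peeling`).

Since `θ*` is a population minimizer, `E g(Z) = 0`, the risk has no linear term, and `V` is positive
definite (`HasSecondOrderTaylorAt.integral_lossRemainder`). The sample of each machine is i.i.d.
because the allocation is independent of the data (`hasLaw_random_subsample`). As the machines
partition the full sample, the average of the linearizations is `-V⁻¹ N^{-1/2} ∑ᵢ g(Zᵢ) + o_P(1)`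
with the sum over all `N = mn` observations, whatever the allocation
(`sqrt_smul_machineAverage_sub`); the central limit theorem and Slutsky's lemma conclude.
-/

/-! ### The empirical process -/

/-- The empirical process `n^{-1/2} ∑ᵢ (ψ(zᵢ) - E ψ)` of `ψ` on the data `z₁, …, zₙ`. -/
noncomputable def empFluct {𝒵 : Type*} [MeasurableSpace 𝒵] (μ : Measure 𝒵) {n : ℕ} (ψ : 𝒵 → ℝ)
    (z : Fin n → 𝒵) : ℝ :=
  (√(n : ℝ))⁻¹ * ∑ i, (ψ (z i) - ∫ x, ψ x ∂μ)

section EmpiricalFluctuation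

variable {𝒵 : Type*} [MeasurableSpace 𝒵] {μ : Measure 𝒵}

lemma empFluct_sub {n : ℕ} {ψ χ : 𝒵 → ℝ} (hψ : Integrable ψ μ) (hχ : Integrable χ μ)
    (z : Fin n → 𝒵) :
    empFluct μ (fun x => ψ x - χ x) z = empFluct μ ψ z - empFluct μ χ z := by
  simp only [empFluct]
  rw [integral_sub hψ hχ, ← mul_sub, ← Finset.sum_sub_distrib]
  congr 1
  exact Finset.sum_congr rfl fun i _ => by ring

lemma empFluct_neg {n : ℕ} {ψ : 𝒵 → ℝ} (z : Fin n → 𝒵) :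
    empFluct μ (fun x => -ψ x) z = -empFluct μ ψ z := by
  simp only [empFluct]
  rw [integral_neg, ← mul_neg, ← Finset.sum_neg_distrib]
  congr 1
  exact Finset.sum_congr rfl fun i _ => by ring

variable [IsProbabilityMeasure μ]

lemma ae_pi_forall {n : ℕ} {q : 𝒵 → Prop} (h : ∀ᵐ z ∂μ, q z) :
    ∀ᵐ z ∂(Measure.pi fun _ : Fin n => μ), ∀ i, q (z i) := by
  rw [ae_all_iff]
  intro i
  exact (measurePreserving_eval (fun _ : Fin n => μ) i).quasiMeasurePreserving.ae h

lemma memLp_empFluct {n : ℕ} {ψ : 𝒵 → ℝ} (hψ : MemLp ψ 2 μ) :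
    MemLp (fun z : Fin n → 𝒵 => empFluct μ ψ z) 2 (Measure.pi fun _ : Fin n => μ) := by
  have h : ∀ i : Fin n, MemLp (fun z : Fin n → 𝒵 => ψ (z i) - ∫ x, ψ x ∂μ) 2
      (Measure.pi fun _ : Fin n => μ) := fun i =>
    MemLp.comp_measurePreserving (g := fun x => ψ x - ∫ x, ψ x ∂μ) (hψ.sub (memLp_const _))
      (measurePreserving_eval (fun _ : Fin n => μ) i)
  have h2 := memLp_finsetSum (μ := Measure.pi fun _ : Fin n => μ) Finset.univ fun i _ => h i
  exact h2.const_mul (√(n : ℝ))⁻¹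

lemma empFluct_chebyshev {n : ℕ} {ψ : 𝒵 → ℝ} (hψ : MemLp ψ 2 μ) {a : ℝ} (ha : 0 < a) :
    (Measure.pi fun _ : Fin n => μ) {z | a ≤ |empFluct μ ψ z|}
      ≤ ENNReal.ofReal ((∫ x, ψ x ^ 2 ∂μ) / a ^ 2) := by
  rcases Nat.eq_zero_or_pos n with rfl | hn
  · simp [empFluct, ha.not_ge]
  set π := Measure.pi fun _ : Fin n => μ
  have hn' : (0 : ℝ) < n := by exact_mod_cast hn
  have hY : MemLp (fun x => ψ x - ∫ x, ψ x ∂μ) 2 μ := hψ.sub (memLp_const _)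
  have hint : ∫ z, empFluct μ ψ z ∂π = 0 := by
    simp only [empFluct]
    rw [integral_const_mul, integral_finsetSum]
    · rw [Finset.sum_eq_zero, mul_zero]
      intro i _
      rw [integral_comp_eval (μ := fun _ : Fin n => μ) (f := fun x => ψ x - ∫ x, ψ x ∂μ)
        hY.aestronglyMeasurable, integral_sub (hψ.integrable (by norm_num)) (integrable_const _)]
      simp
    · intro i _
      exact integrable_comp_eval (μ := fun _ : Fin n => μ) (hY.integrable (by norm_num))
  have hvar : Var[fun z => empFluct μ ψ z; π] ≤ ∫ x, ψ x ^ 2 ∂μ := by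
    simp only [empFluct]
    rw [variance_const_mul]
    have := variance_sum_pi (μ := fun _ : Fin n => μ)
      (X := fun _ x => ψ x - ∫ x, ψ x ∂μ) (fun _ => hY)
    have h2 : (fun z : Fin n → 𝒵 => ∑ i, (ψ (z i) - ∫ x, ψ x ∂μ))
        = ∑ i, fun z : Fin n → 𝒵 => ψ (z i) - ∫ x, ψ x ∂μ := by
      ext z; simp
    rw [h2, this]
    simp only [Finset.sum_const, Finset.card_univ, Fintype.card_fin, nsmul_eq_mul]
    rw [← mul_assoc, inv_pow, Real.sq_sqrt hn'.le, inv_mul_cancel₀ hn'.ne', one_mul,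
      variance_sub_const hψ.aestronglyMeasurable]
    exact variance_le_expectation_sq hψ.aestronglyMeasurable
  have key := meas_ge_le_variance_div_sq (memLp_empFluct (n := n) hψ) ha
  rw [hint] at key
  simp only [sub_zero] at key
  refine key.trans (ENNReal.ofReal_le_ofReal ?_)
  gcongr

lemma empFluct_exp_tail_oneSided {n : ℕ} {ψ : 𝒵 → ℝ} (hψ : AEStronglyMeasurable ψ μ) {d σ : ℝ}
    (hd : 0 < d) (hb : ∀ᵐ x ∂μ, |ψ x| ≤ √(n : ℝ) * d) (hσ : ∫ x, ψ x ^ 2 ∂μ ≤ σ * d ^ 2) (s : ℝ)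
    (hn : 0 < n) :
    (Measure.pi fun _ : Fin n => μ) {z | s * d ≤ empFluct μ ψ z}
      ≤ ENNReal.ofReal (Real.exp (σ / 4 - s / 2)) := by
  set π := Measure.pi fun _ : Fin n => μ
  have hn' : (0 : ℝ) < n := by exact_mod_cast hn
  have hsn : 0 < √(n : ℝ) := Real.sqrt_pos.2 hn'
  set c := ∫ x, ψ x ∂μ with hc
  have hL : MemLp ψ 2 μ := MemLp.of_bound hψ _ (by simpa using hb)
  have hint : Integrable ψ μ := hL.integrable (by norm_num)
  have hcb : |c| ≤ √(n : ℝ) * d := by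
    have := norm_integral_le_of_norm_le_const (μ := μ) (f := ψ) (by simpa using hb)
    simpa using this
  set Y : 𝒵 → ℝ := fun x => (ψ x - c) / (2 * √(n : ℝ) * d) with hYdef
  have hpos : 0 < 2 * √(n : ℝ) * d := by positivity
  have hY1 : ∀ᵐ x ∂μ, |Y x| ≤ 1 := by
    filter_upwards [hb] with x hx
    rw [hYdef, abs_div, abs_of_pos hpos, div_le_one hpos]
    calc |ψ x - c| ≤ |ψ x| + |c| := abs_sub _ _
      _ ≤ 2 * √(n : ℝ) * d := by linarith
  have hYm : AEStronglyMeasurable Y μ :=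
    ((hψ.aemeasurable.sub_const c).div_const _).aestronglyMeasurable
  have hYL : MemLp Y 2 μ := MemLp.of_bound hYm 1 (by simpa using hY1)
  have hYint : Integrable Y μ := hYL.integrable (by norm_num)
  have hY0 : ∫ x, Y x ∂μ = 0 := by
    simp only [hYdef]
    rw [integral_div, integral_sub hint (integrable_const _)]
    simp [hc]
  have hY2 : ∫ x, Y x ^ 2 ∂μ ≤ σ / (4 * n) := by
    have h1 : ∫ x, Y x ^ 2 ∂μ = (∫ x, (ψ x - c) ^ 2 ∂μ) / (4 * n * d ^ 2) := by
      rw [← integral_div]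
      congr 1; ext x
      simp only [hYdef, div_pow, mul_pow, Real.sq_sqrt hn'.le]
      norm_num
    have h2 : ∫ x, (ψ x - c) ^ 2 ∂μ ≤ σ * d ^ 2 := by
      rw [hc, ← variance_eq_integral hψ.aemeasurable]
      exact (variance_le_expectation_sq hψ).trans hσ
    rw [h1, div_le_div_iff₀ (by positivity) (by positivity)]
    nlinarith [mul_le_mul_of_nonneg_left h2 (by positivity : (0 : ℝ) ≤ 4 * n)]
  have hexpint : Integrable (fun x => Real.exp (Y x)) μ := by
    refine Integrable.of_bound (Real.continuous_exp.comp_aestronglyMeasurable hYm) (Real.exp 1) ?_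
    filter_upwards [hY1] with x hx
    rw [Real.norm_eq_abs, abs_of_pos (Real.exp_pos _)]
    exact Real.exp_le_exp.2 ((le_abs_self _).trans hx)
  -- `exp y ≤ 1 + y + y²` on `[-1, 1]`; the linear term integrates to zero
  have hmgf : ∫ x, Real.exp (Y x) ∂μ ≤ Real.exp (σ / (4 * n)) := by
    calc ∫ x, Real.exp (Y x) ∂μ ≤ ∫ x, (1 + Y x + Y x ^ 2) ∂μ := by
          refine integral_mono_ae hexpint
            (((integrable_const _).add hYint).add hYL.integrable_sq) ?_
          filter_upwards [hY1] with x hx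
          have := (abs_le.1 (Real.abs_exp_sub_one_sub_id_le hx)).2
          linarith
      _ = 1 + ∫ x, Y x ^ 2 ∂μ := by
          have h1Y : Integrable (fun x => 1 + Y x) μ := (integrable_const _).add hYint
          rw [integral_add h1Y hYL.integrable_sq, integral_add (integrable_const _) hYint, hY0]
          simp
      _ ≤ Real.exp (σ / (4 * n)) := by
          linarith [Real.add_one_le_exp (σ / (4 * n))]
  have hprod : ∀ z : Fin n → 𝒵, Real.exp (empFluct μ ψ z / (2 * d)) = ∏ i, Real.exp (Y (z i)) := by
    intro z
    rw [← Real.exp_sum]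
    congr 1
    simp only [empFluct, hYdef, ← Finset.sum_div, ← hc]
    field_simp
  have hE : ∫ z, Real.exp (empFluct μ ψ z / (2 * d)) ∂π ≤ Real.exp (σ / 4) := by
    simp_rw [hprod]
    rw [integral_fintype_prod_eq_pow (fun x => Real.exp (Y x)), Fintype.card_fin]
    calc (∫ x, Real.exp (Y x) ∂μ) ^ n ≤ Real.exp (σ / (4 * n)) ^ n := by
          gcongr
      _ = Real.exp (σ / 4) := by
          rw [← Real.exp_nat_mul]
          congr 1
          field_simp
  have hI : Integrable (fun z => Real.exp (empFluct μ ψ z / (2 * d))) π := by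
    simp_rw [hprod]
    exact Integrable.fintype_prod (μ := fun _ : Fin n => μ) fun _ => hexpint
  have hM := mul_meas_ge_le_integral_of_nonneg (μ := π)
    (Eventually.of_forall fun z => (Real.exp_pos (empFluct μ ψ z / (2 * d))).le) hI
    (Real.exp (s / 2))
  have hset : {z | s * d ≤ empFluct μ ψ z}
      = {z : Fin n → 𝒵 | Real.exp (s / 2) ≤ Real.exp (empFluct μ ψ z / (2 * d))} := by
    ext z
    simp only [Set.mem_ofPred_eq, Real.exp_le_exp]
    rw [div_le_div_iff₀ (by norm_num) (by positivity)]
    constructor <;> intro h <;> linarith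
  rw [hset, ← ofReal_measureReal]
  refine ENNReal.ofReal_le_ofReal ?_
  rw [Real.exp_sub, le_div_iff₀ (Real.exp_pos _), mul_comm]
  exact hM.trans hE

/-- Bernstein-type inequality: if `ψ` is bounded by `√n d` and has second moment at most `σ d²`,
its empirical process has exponential tails at scale `d`. -/
lemma empFluct_exp_tail {n : ℕ} {ψ : 𝒵 → ℝ} (hψ : AEStronglyMeasurable ψ μ) {d σ : ℝ}
    (hd : 0 < d) (hb : ∀ᵐ x ∂μ, |ψ x| ≤ √(n : ℝ) * d) (hσ : ∫ x, ψ x ^ 2 ∂μ ≤ σ * d ^ 2) (s : ℝ)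
    (hn : 0 < n) :
    (Measure.pi fun _ : Fin n => μ) {z | s * d ≤ |empFluct μ ψ z|}
      ≤ ENNReal.ofReal (2 * Real.exp (σ / 4) * Real.exp (-(s / 2))) := by
  have h1 := empFluct_exp_tail_oneSided hψ hd hb hσ s hn
  have h2 := empFluct_exp_tail_oneSided (ψ := fun x => -ψ x) hψ.neg hd (by simpa using hb)
    (by simpa using hσ) s hn
  have hsub : {z : Fin n → 𝒵 | s * d ≤ |empFluct μ ψ z|}
      ⊆ {z | s * d ≤ empFluct μ ψ z} ∪ {z | s * d ≤ empFluct μ (fun x => -ψ x) z} := by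
    intro z hz
    simp only [Set.mem_ofPred_eq, le_abs] at hz
    simpa only [Set.mem_union, Set.mem_ofPred_eq, empFluct_neg] using hz
  refine (measure_mono hsub).trans ((measure_union_le _ _).trans ((add_le_add h1 h2).trans ?_))
  rw [← ENNReal.ofReal_add (Real.exp_pos _).le (Real.exp_pos _).le, sub_eq_add_neg, Real.exp_add]
  exact ENNReal.ofReal_le_ofReal (by linarith)

end EmpiricalFluctuation

/-! ### Chaining over dyadic grids -/

section Chaining

variable {p : ℕ}

/-- The grid point `4^{-k} ⌊4^k u⌋` (coordinatewise) below `u`. -/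
noncomputable def gridProj (p k : ℕ) (u : EuclideanSpace ℝ (Fin p)) : EuclideanSpace ℝ (Fin p) :=
  WithLp.toLp 2 fun i => (⌊(4 : ℝ) ^ k * u i⌋ : ℝ) / 4 ^ k

lemma norm_gridProj_sub_le (k : ℕ) (u : EuclideanSpace ℝ (Fin p)) :
    ‖gridProj p k u - u‖ ≤ √p / 4 ^ k := by
  have h4 : (0 : ℝ) < 4 ^ k := by positivity
  rw [EuclideanSpace.norm_eq]
  refine Real.sqrt_le_iff.2 ⟨by positivity, ?_⟩
  rw [div_pow, Real.sq_sqrt (Nat.cast_nonneg p)]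
  calc ∑ i, ‖(gridProj p k u - u) i‖ ^ 2 ≤ ∑ _i : Fin p, 1 / ((4 : ℝ) ^ k) ^ 2 := by
        refine Finset.sum_le_sum fun i _ => ?_
        have h1 := Int.floor_le ((4 : ℝ) ^ k * u i)
        have h2 := Int.lt_floor_add_one ((4 : ℝ) ^ k * u i)
        have h3 : (gridProj p k u - u) i = (⌊(4 : ℝ) ^ k * u i⌋ - 4 ^ k * u i) / 4 ^ k := by
          simp only [gridProj, PiLp.sub_apply]
          field_simp
        rw [h3, Real.norm_eq_abs, sq_abs, div_pow]
        gcongr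
        nlinarith
    _ = p / ((4 : ℝ) ^ k) ^ 2 := by simp [div_eq_mul_inv]

lemma norm_gridProj_le (k : ℕ) {u : EuclideanSpace ℝ (Fin p)} (hu : ‖u‖ ≤ 1) :
    ‖gridProj p k u‖ ≤ 1 + √p := by
  have h1 := norm_gridProj_sub_le k u
  have h2 : √p / 4 ^ k ≤ √p := div_le_self (Real.sqrt_nonneg _) (one_le_pow₀ (by norm_num))
  calc ‖gridProj p k u‖ = ‖u + (gridProj p k u - u)‖ := by congr 1; abel
    _ ≤ ‖u‖ + ‖gridProj p k u - u‖ := norm_add_le _ _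
    _ ≤ 1 + √p := by linarith

lemma tendsto_gridProj (u : EuclideanSpace ℝ (Fin p)) :
    Tendsto (fun k => gridProj p k u) atTop (𝓝 u) := by
  rw [tendsto_iff_norm_sub_tendsto_zero]
  refine squeeze_zero (fun _ => norm_nonneg _) (fun k => norm_gridProj_sub_le k u) ?_
  have := (tendsto_pow_atTop_nhds_zero_of_lt_one (r := (1 / 4 : ℝ)) (by norm_num)
    (by norm_num)).const_mul √p
  simpa [div_eq_mul_inv] using this

/-- The finitely many grid points of mesh `4^{-k}` that are below a point of the unit ball. -/
noncomputable def grid (p k : ℕ) : Finset (EuclideanSpace ℝ (Fin p)) :=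
  (Fintype.piFinset fun _ : Fin p => Finset.Icc (-(4 : ℤ) ^ k) (4 ^ k)).map
    ⟨fun a => WithLp.toLp 2 fun i => (a i : ℝ) / 4 ^ k, fun a b h => by
      ext i
      have := congrArg (fun v : EuclideanSpace ℝ (Fin p) => v i) h
      have h4 : (4 : ℝ) ^ k ≠ 0 := by positivity
      simp only [div_left_inj' h4] at this
      exact_mod_cast this⟩

lemma card_grid_le (k : ℕ) : ((grid p k).card : ℝ) ≤ 4 ^ ((k + 1) * p) := by
  have : (grid p k).card ≤ 4 ^ ((k + 1) * p) := by
    rw [grid, Finset.card_map, Fintype.card_piFinset, Finset.prod_const, Finset.card_univ,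
      Fintype.card_fin, pow_mul, Int.card_Icc]
    have h1 : (1 : ℤ) ≤ 4 ^ k := one_le_pow₀ (by norm_num)
    refine Nat.pow_le_pow_left ?_ p
    zify
    rw [Int.toNat_of_nonneg (by linarith), pow_succ]
    linarith
  exact_mod_cast this

lemma gridProj_mem_grid (k : ℕ) {u : EuclideanSpace ℝ (Fin p)} (hu : ‖u‖ ≤ 1) :
    gridProj p k u ∈ grid p k := by
  simp only [grid, Finset.mem_map, Fintype.mem_piFinset, Finset.mem_Icc]
  refine ⟨fun i => ⌊(4 : ℝ) ^ k * u i⌋, fun i => ?_, rfl⟩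
  have hui : |u i| ≤ 1 := by
    have := (PiLp.norm_apply_le u i).trans hu
    simpa using this
  have h4 : (0 : ℝ) < 4 ^ k := by positivity
  have h1 := (abs_le.1 hui).1
  have h2 := (abs_le.1 hui).2
  constructor
  · rw [Int.le_floor]
    push_cast
    nlinarith
  · rw [← Int.cast_le (R := ℝ)]
    refine (Int.floor_le _).trans ?_
    push_cast
    nlinarith

/-- Chaining: a process whose increments satisfy `P(|X u - X v| > s ‖u - v‖) ≤ B s^{-(4p+1)}` is,
up to an event of probability `ε B`, uniformly within `t` of its values on a finite grid that does
not depend on the process. -/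
lemma exists_finset_chaining (p : ℕ) {t ε : ℝ} (ht : 0 < t) (hε : 0 < ε) :
    ∃ F : Finset (EuclideanSpace ℝ (Fin p)), (∀ v ∈ F, ‖v‖ ≤ 1 + √p) ∧
      ∀ {Ω : Type*} [MeasurableSpace Ω] (P : Measure Ω)
        (X : EuclideanSpace ℝ (Fin p) → Ω → ℝ) (B : ℝ), 0 ≤ B →
        (∀ᵐ ω ∂P, ContinuousOn (fun u => X u ω) (Metric.closedBall 0 (1 + √p))) →
        (∀ u v, ‖u‖ ≤ 1 + √p → ‖v‖ ≤ 1 + √p → u ≠ v → ∀ s, 0 < s →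
          P {ω | s * ‖u - v‖ ≤ |X u ω - X v ω|} ≤ ENNReal.ofReal (B / s ^ (4 * p + 1))) →
        P {ω | ∃ u, ‖u‖ ≤ 1 ∧ ∀ v ∈ F, t < |X u ω - X v ω|} ≤ ENNReal.ofReal (ε * B) := by
  classical
  set c : ℝ := 2 * √p + 1 with hc
  have hcpos : 0 < c := by positivity
  set D : ℝ := 64 ^ p * (2 * c / t) ^ (4 * p + 1) with hD
  have hDpos : 0 < D := by positivity
  obtain ⟨K, hK⟩ : ∃ K : ℕ, 2 * D / 2 ^ K ≤ ε := by
    obtain ⟨K, hK⟩ := pow_unbounded_of_one_lt (2 * D / ε) (one_lt_two)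
    refine ⟨K, ?_⟩
    rw [div_le_iff₀ (by positivity)]
    rw [div_lt_iff₀ hε] at hK
    linarith
  refine ⟨(grid p K).filter fun v => ‖v‖ ≤ 1 + √p, fun v hv => (Finset.mem_filter.1 hv).2, ?_⟩
  intro Ω _ P X B hB hcont hincr
  -- the scale of level `k`, for which the level-`k` oscillations sum to at most `t`
  set s : ℕ → ℝ := fun k => t * 2 ^ k / (2 * c) with hs
  have hspos : ∀ k, 0 < s k := fun k => by positivity
  set G : ℕ → Finset (EuclideanSpace ℝ (Fin p) × EuclideanSpace ℝ (Fin p)) := fun k =>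
    ((grid p k) ×ˢ (grid p (k + 1))).filter
      fun vw => ‖vw.1‖ ≤ 1 + √p ∧ ‖vw.2‖ ≤ 1 + √p ∧ vw.1 ≠ vw.2 with hG
  set bad : ℕ → Set Ω := fun k => ⋃ vw ∈ G k,
    {ω | s k * ‖vw.1 - vw.2‖ ≤ |X vw.1 ω - X vw.2 ω|} with hbad
  have hbadP : ∀ i, P (bad (K + i)) ≤ ENNReal.ofReal (2 * (D * B) / 2 ^ K / 2 / 2 ^ i) := by
    intro i
    set k := K + i with hk
    have h1 : P (bad k) ≤ ∑ _vw ∈ G k, ENNReal.ofReal (B / s k ^ (4 * p + 1)) := by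
      refine (measure_biUnion_finset_le _ _).trans (Finset.sum_le_sum fun vw hvw => ?_)
      obtain ⟨-, h1, h2, h3⟩ := Finset.mem_filter.1 hvw
      exact hincr _ _ h1 h2 h3 _ (hspos k)
    refine h1.trans ?_
    rw [Finset.sum_const, nsmul_eq_mul, ← ENNReal.ofReal_natCast,
      ← ENNReal.ofReal_mul (Nat.cast_nonneg _)]
    refine ENNReal.ofReal_le_ofReal ?_
    have hcard : ((G k).card : ℝ) ≤ 4 ^ ((k + 1) * p) * 4 ^ ((k + 1 + 1) * p) := by
      have : (G k).card ≤ (grid p k).card * (grid p (k + 1)).card := by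
        rw [← Finset.card_product]
        exact Finset.card_filter_le _ _
      calc ((G k).card : ℝ) ≤ ((grid p k).card : ℝ) * ((grid p (k + 1)).card : ℝ) := by
            exact_mod_cast this
        _ ≤ _ := mul_le_mul (card_grid_le k) (card_grid_le (k + 1)) (Nat.cast_nonneg _)
            (by positivity)
    calc ((G k).card : ℝ) * (B / s k ^ (4 * p + 1))
        ≤ 4 ^ ((k + 1) * p) * 4 ^ ((k + 1 + 1) * p) * (B / s k ^ (4 * p + 1)) :=
          mul_le_mul_of_nonneg_right hcard (by have := hspos k; positivity)
      _ = 2 * (D * B) / 2 ^ K / 2 / 2 ^ i := by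
          have e1 : (4 : ℝ) ^ ((k + 1) * p) * 4 ^ ((k + 1 + 1) * p)
              = 64 ^ p * 2 ^ (k * (4 * p)) := by
            rw [show (64 : ℝ) = 2 ^ 6 by norm_num, show (4 : ℝ) = 2 ^ 2 by norm_num]
            simp only [← pow_mul, ← pow_add]
            congr 1; ring
          have e2 : s k ^ (4 * p + 1) = (2 ^ (k * (4 * p)) * (2 ^ K * 2 ^ i))
              / (2 * c / t) ^ (4 * p + 1) := by
            rw [hs, ← pow_add, ← hk, ← pow_add, show k * (4 * p) + k = k * (4 * p + 1) by ring,
              pow_mul, ← div_pow]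
            congr 1
            field_simp
          rw [e1, e2, hD]
          field_simp
  have hsum : P (⋃ i, bad (K + i)) ≤ ENNReal.ofReal (ε * B) := by
    refine (measure_iUnion_le _).trans ((ENNReal.tsum_le_tsum hbadP).trans ?_)
    rw [← ENNReal.ofReal_tsum_of_nonneg (fun i => by positivity) (summable_geometric_two' _),
      tsum_geometric_two']
    refine ENNReal.ofReal_le_ofReal ?_
    calc 2 * (D * B) / 2 ^ K = 2 * D / 2 ^ K * B := by ring
      _ ≤ ε * B := mul_le_mul_of_nonneg_right hK hB
  refine le_trans (measure_mono_ae ?_) hsum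
  filter_upwards [hcont] with ω hω hex
  obtain ⟨u, hu, huF⟩ := hex
  by_contra hgood
  have hstep : ∀ i, |X (gridProj p (K + i) u) ω - X (gridProj p (K + (i + 1)) u) ω|
      ≤ t / 2 ^ (i + 1) := by
    intro i
    by_cases hne : gridProj p (K + i) u = gridProj p (K + (i + 1)) u
    · rw [hne, sub_self, abs_zero]; positivity
    have hnot : ω ∉ bad (K + i) := fun h => hgood (Set.mem_iUnion.2 ⟨i, h⟩)
    have hmem : (gridProj p (K + i) u, gridProj p (K + (i + 1)) u) ∈ G (K + i) :=
      Finset.mem_filter.2 ⟨Finset.mem_product.2 ⟨gridProj_mem_grid _ hu, gridProj_mem_grid _ hu⟩,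
        norm_gridProj_le _ hu, norm_gridProj_le _ hu, hne⟩
    have hlt : |X (gridProj p (K + i) u) ω - X (gridProj p (K + (i + 1)) u) ω|
        < s (K + i) * ‖gridProj p (K + i) u - gridProj p (K + (i + 1)) u‖ := by
      by_contra hcon
      exact hnot (Set.mem_biUnion hmem (not_lt.1 hcon))
    have hdist : ‖gridProj p (K + i) u - gridProj p (K + (i + 1)) u‖ ≤ c / 4 ^ (K + i) := by
      have h1 := norm_gridProj_sub_le (K + i) u
      have h2 := norm_gridProj_sub_le (K + (i + 1)) u
      have h3 : √p / 4 ^ (K + (i + 1)) ≤ √p / 4 ^ (K + i) := by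
        gcongr
        · norm_num
        · omega
      calc _ = ‖(gridProj p (K + i) u - u) - (gridProj p (K + (i + 1)) u - u)‖ := by
            congr 1; abel
        _ ≤ _ := norm_sub_le _ _
        _ ≤ 2 * (√p / 4 ^ (K + i)) := by linarith
        _ ≤ c / 4 ^ (K + i) := by
            rw [hc, add_div, mul_div_assoc]
            have : (0 : ℝ) ≤ 1 / 4 ^ (K + i) := by positivity
            linarith
    refine hlt.le.trans ((mul_le_mul_of_nonneg_left hdist (hspos _).le).trans ?_)
    have e : s (K + i) * (c / 4 ^ (K + i)) = t / 2 ^ (K + i + 1) := by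
      rw [hs, show (4 : ℝ) = 2 * 2 by norm_num, mul_pow, pow_succ]
      field_simp
    rw [e]
    gcongr
    · norm_num
    · omega
  have htel : ∀ i, |X (gridProj p (K + i) u) ω - X (gridProj p K u) ω| ≤ t * (1 - 1 / 2 ^ i) := by
    intro i
    induction i with
    | zero => simp
    | succ i ih =>
      have h1 := hstep i
      have h2 := abs_sub_le (X (gridProj p (K + (i + 1)) u) ω) (X (gridProj p (K + i) u) ω)
        (X (gridProj p K u) ω)
      rw [abs_sub_comm (X (gridProj p (K + (i + 1)) u) ω) (X (gridProj p (K + i) u) ω)] at h2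
      have e : t * (1 - 1 / 2 ^ (i + 1)) = t / 2 ^ (i + 1) + t * (1 - 1 / 2 ^ i) := by
        rw [pow_succ]; field_simp; ring
      linarith
  have hlim : Tendsto (fun i => X (gridProj p (K + i) u) ω) atTop (𝓝 (X u ω)) := by
    have hu' : u ∈ Metric.closedBall (0 : EuclideanSpace ℝ (Fin p)) (1 + √p) := by
      rw [mem_closedBall_zero_iff]
      linarith [Real.sqrt_nonneg (p : ℝ)]
    have h1 : Tendsto (fun i => gridProj p (K + i) u) atTop
        (𝓝[Metric.closedBall 0 (1 + √p)] u) := by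
      refine tendsto_nhdsWithin_iff.2 ⟨?_, Eventually.of_forall fun i => ?_⟩
      · exact (tendsto_gridProj u).comp (tendsto_add_atTop_nat K |>.congr fun i => by ring)
      · rw [mem_closedBall_zero_iff]
        exact norm_gridProj_le _ hu
    exact (hω u hu').tendsto.comp h1
  have hle : |X u ω - X (gridProj p K u) ω| ≤ t := by
    refine le_of_tendsto ((hlim.sub_const _).abs) (Eventually.of_forall fun i => (htel i).trans ?_)
    have : (0 : ℝ) ≤ 1 / 2 ^ i := by positivity
    nlinarith
  exact absurd (huF _ (Finset.mem_filter.2 ⟨gridProj_mem_grid _ hu, norm_gridProj_le _ hu⟩))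
    (not_lt.2 hle)

end Chaining

/-! ### Stochastic differentiability -/

section StochasticDifferentiability

variable {𝒵 : Type*} [MeasurableSpace 𝒵] {μ : Measure 𝒵} {p : ℕ}

/-- The constant in the polynomial tail bound deduced from the exponential one. -/
noncomputable def tailConst (p : ℕ) (σ : ℝ) : ℝ :=
  2 * Real.exp (σ / 4) * (2 ^ (4 * p + 1) * (4 * p + 1).factorial)

lemma tailConst_pos (p : ℕ) (σ : ℝ) : 0 < tailConst p σ := by
  unfold tailConst; positivity

lemma exp_tail_le_tailConst (p : ℕ) (σ : ℝ) {y : ℝ} (hy : 0 < y) :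
    2 * Real.exp (σ / 4) * Real.exp (-(y / 2)) ≤ tailConst p σ / y ^ (4 * p + 1) := by
  rw [tailConst, mul_div_assoc]
  refine mul_le_mul_of_nonneg_left ?_ (by positivity)
  have h := Real.pow_div_factorial_le_exp (y / 2) (by positivity) (4 * p + 1)
  rw [Real.exp_neg, inv_le_comm₀ (Real.exp_pos _) (by positivity)]
  refine le_trans (le_of_eq ?_) h
  rw [div_pow]
  field_simp

lemma tendsto_integral_sq_indicator_sqrt_lt {L : 𝒵 → ℝ} (hLm : Measurable L) (hL : MemLp L 2 μ) :
    Tendsto (fun n : ℕ => ∫ z, {z | √(n : ℝ) < L z}.indicator (fun z => L z ^ 2) z ∂μ) atTop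
      (𝓝 0) := by
  rw [← integral_zero 𝒵 ℝ (μ := μ)]
  refine tendsto_integral_of_dominated_convergence (fun z => L z ^ 2) (fun n => ?_)
    hL.integrable_sq (fun n => ?_) ?_
  · exact ((hLm.pow_const 2).indicator (measurableSet_lt measurable_const hLm)).aestronglyMeasurable
  · refine Eventually.of_forall fun z => ?_
    refine (norm_indicator_le_norm_self _ _).trans ?_
    rw [Real.norm_eq_abs, abs_of_nonneg (sq_nonneg _)]
  · refine Eventually.of_forall fun z => ?_
    have h : ∀ᶠ n : ℕ in atTop, L z ≤ √(n : ℝ) :=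
      (Real.tendsto_sqrt_atTop.comp tendsto_natCast_atTop_atTop).eventually_ge_atTop (L z)
    refine tendsto_const_nhds.congr' ?_
    filter_upwards [h] with n hn
    rw [Set.indicator_of_notMem]
    simpa using hn

variable [IsProbabilityMeasure μ]

/-- Peeling: the truncated empirical process is controlled on all dyadic shells
`‖h‖ ≈ 2^j / √n` at once, by chaining within the shell from the finite set `F` and by Chebyshev's
inequality on `F`. -/
lemma empFluct_peeling {n : ℕ} (hn : 0 < n) {χ : 𝒵 → EuclideanSpace ℝ (Fin p) → ℝ} {r : ℝ}
    (hm : ∀ h, ‖h‖ ≤ r → AEStronglyMeasurable (fun z => χ z h) μ) (hr : 0 ≤ r)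
    (h0 : ∀ z, χ z 0 = 0) {ℓ : 𝒵 → ℝ} (hℓm : AEStronglyMeasurable ℓ μ) (hℓ0 : ∀ z, 0 ≤ ℓ z)
    (hℓn : ∀ z, ℓ z ≤ √(n : ℝ)) {σ : ℝ} (hσ : ∫ z, ℓ z ^ 2 ∂μ ≤ σ)
    (hlip : ∀ᵐ z ∂μ, ∀ h h', ‖h‖ ≤ r → ‖h'‖ ≤ r → |χ z h - χ z h'| ≤ ℓ z * ‖h - h'‖)
    {η : ℝ} (hη : 0 ≤ η) (hsmall : ∀ h, ‖h‖ ≤ r → ∫ z, χ z h ^ 2 ∂μ ≤ η * ‖h‖ ^ 2)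
    {t ε : ℝ} (ht : 0 < t) (hε : 0 < ε) {F : Finset (EuclideanSpace ℝ (Fin p))}
    (hF1 : ∀ v ∈ F, ‖v‖ ≤ 1 + √p)
    (hF : ∀ (X : EuclideanSpace ℝ (Fin p) → (Fin n → 𝒵) → ℝ) (B : ℝ), 0 ≤ B →
        (∀ᵐ z ∂(Measure.pi fun _ : Fin n => μ),
          ContinuousOn (fun u => X u z) (Metric.closedBall 0 (1 + √p))) →
        (∀ u v, ‖u‖ ≤ 1 + √p → ‖v‖ ≤ 1 + √p → u ≠ v → ∀ s, 0 < s →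
          (Measure.pi fun _ : Fin n => μ) {z | s * ‖u - v‖ ≤ |X u z - X v z|}
            ≤ ENNReal.ofReal (B / s ^ (4 * p + 1))) →
        (Measure.pi fun _ : Fin n => μ) {z | ∃ u, ‖u‖ ≤ 1 ∧ ∀ v ∈ F, t < |X u z - X v z|}
          ≤ ENNReal.ofReal (ε * B))
    {δ : ℝ} (hδr : 2 * δ * (1 + √p) ≤ r) (hnδ : 1 / √(n : ℝ) ≤ 2 * δ) :
    (Measure.pi fun _ : Fin n => μ) {z | ∃ h, ‖h‖ ≤ δ ∧
        8 * t * (√(n : ℝ) * ‖h‖ ^ 2 + 1 / √(n : ℝ)) < |empFluct μ (fun x => χ x h) z|}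
      ≤ ENNReal.ofReal
          (2 * (ε * tailConst p σ + F.card * (η * (1 + √p) ^ 2 / t ^ 2))) := by
  set π := Measure.pi fun _ : Fin n => μ with hπ
  have hn' : (0 : ℝ) < n := by exact_mod_cast hn
  have hsn : 0 < √(n : ℝ) := Real.sqrt_pos.2 hn'
  have hp1 : (0 : ℝ) < 1 + √p := by positivity
  set ρ : ℕ → ℝ := fun j => 2 ^ j / √(n : ℝ) with hρ
  have hρpos : ∀ j, 0 < ρ j := fun j => by positivity
  have hℓL : MemLp ℓ 2 μ := MemLp.of_bound hℓm (√(n : ℝ)) (Eventually.of_forall fun z => by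
    rw [Real.norm_eq_abs, abs_of_nonneg (hℓ0 z)]; exact hℓn z)
  have hχL : ∀ h, ‖h‖ ≤ r → MemLp (fun z => χ z h) 2 μ := by
    intro h hh
    refine (hℓL.mul_const ‖h‖).of_le (hm h hh) ?_
    filter_upwards [hlip] with z hz
    have := hz h 0 hh (by simpa using hr)
    rw [h0, sub_zero, sub_zero] at this
    exact this.trans (le_abs_self _)
  have hχI : ∀ h, ‖h‖ ≤ r → Integrable (fun z => χ z h) μ := fun h hh =>
    (hχL h hh).integrable (by norm_num)
  have hcontG : ∀ᵐ z ∂π, ContinuousOn (fun h => empFluct μ (fun x => χ x h) z)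
      (Metric.closedBall 0 r) := by
    have hLip : ∀ᵐ x ∂μ, ContinuousOn (fun h => χ x h) (Metric.closedBall 0 r) := by
      filter_upwards [hlip] with x hx
      refine LipschitzOnWith.continuousOn (K := (ℓ x).toNNReal) ?_
      refine LipschitzOnWith.of_dist_le_mul fun h hh h' hh' => ?_
      rw [Real.dist_eq, dist_eq_norm, Real.coe_toNNReal _ (hℓ0 x)]
      exact hx h h' (by simpa using hh) (by simpa using hh')
    have hint : ContinuousOn (fun h => ∫ x, χ x h ∂μ) (Metric.closedBall 0 r) := by
      refine LipschitzOnWith.continuousOn (K := (∫ x, ℓ x ∂μ).toNNReal) ?_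
      refine LipschitzOnWith.of_dist_le_mul fun h hh h' hh' => ?_
      rw [mem_closedBall_zero_iff] at hh hh'
      rw [Real.dist_eq, dist_eq_norm, Real.coe_toNNReal _ (integral_nonneg hℓ0),
        ← integral_sub (hχI h hh) (hχI h' hh'), ← integral_mul_const]
      rw [← Real.norm_eq_abs]
      refine norm_integral_le_of_norm_le ((hℓL.integrable (by norm_num)).mul_const _) ?_
      filter_upwards [hlip] with x hx
      exact hx h h' hh hh'
    filter_upwards [ae_pi_forall (n := n) hLip] with z hz
    simp only [empFluct]
    exact continuousOn_const.mul (continuousOn_finsetSum _ fun i _ => (hz i).sub hint)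
  -- the rescaled process on the `j`-th shell
  set X : ℕ → EuclideanSpace ℝ (Fin p) → (Fin n → 𝒵) → ℝ := fun j u z =>
    empFluct μ (fun x => χ x (ρ j • u)) z / (ρ j * 2 ^ j) with hX
  have hscale : ∀ j, ρ j ≤ 2 * δ → ∀ u : EuclideanSpace ℝ (Fin p), ‖u‖ ≤ 1 + √p →
      ‖ρ j • u‖ ≤ r := by
    intro j hj u hu
    rw [norm_smul, Real.norm_eq_abs, abs_of_pos (hρpos j)]
    exact (mul_le_mul hj hu (norm_nonneg _) ((hρpos j).le.trans hj)).trans hδr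
  set bad1 : ℕ → Set (Fin n → 𝒵) := fun j =>
    {z | ∃ u, ‖u‖ ≤ 1 ∧ ∀ v ∈ F, t < |X j u z - X j v z|} with hbad1
  set bad2 : ℕ → Set (Fin n → 𝒵) := fun j => ⋃ v ∈ F, {z | t ≤ |X j v z|} with hbad2
  have hP1 : ∀ j, ρ j ≤ 2 * δ → π (bad1 j) ≤ ENNReal.ofReal (ε * tailConst p σ / 2 ^ j) := by
    intro j hj
    refine (hF (X j) (tailConst p σ / (2 ^ j) ^ (4 * p + 1))
      (by have := tailConst_pos p σ; positivity) ?_ ?_).trans (ENNReal.ofReal_le_ofReal ?_)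
    · filter_upwards [hcontG] with z hz
      refine ContinuousOn.div_const ?_ _
      refine hz.comp (by fun_prop) fun u hu => ?_
      rw [mem_closedBall_zero_iff] at hu ⊢
      exact hscale j hj u hu
    · intro u v hu hv huv s hs
      have hd : 0 < ρ j * ‖u - v‖ := mul_pos (hρpos j) (norm_pos_iff.2 (sub_ne_zero.2 huv))
      have hu' := hscale j hj u hu
      have hv' := hscale j hj v hv
      have hb : ∀ᵐ x ∂μ, |χ x (ρ j • u) - χ x (ρ j • v)| ≤ ℓ x * (ρ j * ‖u - v‖) := by
        filter_upwards [hlip] with x hx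
        have := hx _ _ hu' hv'
        rwa [← smul_sub, norm_smul, Real.norm_eq_abs, abs_of_pos (hρpos j)] at this
      have hexp := empFluct_exp_tail (n := n) (μ := μ)
        (ψ := fun x => χ x (ρ j • u) - χ x (ρ j • v)) (σ := σ) (d := ρ j * ‖u - v‖)
        ((hm _ hu').sub (hm _ hv')) hd
        (hb.mono fun x hx => hx.trans (mul_le_mul_of_nonneg_right (hℓn x) hd.le)) ?_ (s * 2 ^ j) hn
      · refine le_trans (measure_mono fun z hz => ?_) (hexp.trans (ENNReal.ofReal_le_ofReal
          ((exp_tail_le_tailConst p σ (by positivity)).trans (le_of_eq ?_))))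
        · rw [Set.mem_ofPred_eq] at hz ⊢
          rw [empFluct_sub (hχI _ hu') (hχI _ hv')]
          simp only [hX, ← sub_div] at hz
          have hpos : 0 < ρ j * 2 ^ j := mul_pos (hρpos j) (by positivity)
          rw [abs_div, abs_of_pos hpos, le_div_iff₀ hpos] at hz
          refine le_trans (le_of_eq ?_) hz
          ring
        · rw [mul_pow]
          field_simp
      · calc ∫ x, (χ x (ρ j • u) - χ x (ρ j • v)) ^ 2 ∂μ
            ≤ ∫ x, ℓ x ^ 2 * (ρ j * ‖u - v‖) ^ 2 ∂μ := by
              refine integral_mono_ae ((hχL _ hu').sub (hχL _ hv')).integrable_sq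
                (hℓL.integrable_sq.mul_const _) ?_
              filter_upwards [hb] with x hx
              rw [← mul_pow, ← sq_abs]
              gcongr
          _ = (∫ x, ℓ x ^ 2 ∂μ) * (ρ j * ‖u - v‖) ^ 2 := integral_mul_const _ _
          _ ≤ σ * (ρ j * ‖u - v‖) ^ 2 := mul_le_mul_of_nonneg_right hσ (sq_nonneg _)
    · rw [mul_div_assoc]
      refine mul_le_mul_of_nonneg_left ?_ hε.le
      refine div_le_div_of_nonneg_left (tailConst_pos p σ).le (by positivity) ?_
      exact le_self_pow₀ (one_le_pow₀ (by norm_num)) (by omega)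
  have hP2 : ∀ j, ρ j ≤ 2 * δ →
      π (bad2 j) ≤ ENNReal.ofReal (F.card * (η * (1 + √p) ^ 2 / t ^ 2) / 2 ^ j) := by
    intro j hj
    have hone : ∀ v ∈ F, π {z | t ≤ |X j v z|}
        ≤ ENNReal.ofReal (η * (1 + √p) ^ 2 / t ^ 2 / 2 ^ j) := by
      intro v hv
      have hv1 := hF1 v hv
      have hv' := hscale j hj v hv1
      have hpos : 0 < ρ j * 2 ^ j := mul_pos (hρpos j) (by positivity)
      have hch := empFluct_chebyshev (n := n) (hχL _ hv') (a := t * (ρ j * 2 ^ j))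
        (mul_pos ht hpos)
      refine le_trans (measure_mono fun z hz => ?_) (hch.trans (ENNReal.ofReal_le_ofReal ?_))
      · rw [Set.mem_ofPred_eq] at hz ⊢
        simp only [hX] at hz
        rwa [abs_div, abs_of_pos hpos, le_div_iff₀ hpos] at hz
      · have h1 : ∫ x, χ x (ρ j • v) ^ 2 ∂μ ≤ η * (ρ j * (1 + √p)) ^ 2 := by
          refine (hsmall _ hv').trans (mul_le_mul_of_nonneg_left ?_ hη)
          rw [norm_smul, Real.norm_eq_abs, abs_of_pos (hρpos j)]
          have := (hρpos j).le
          gcongr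
        have hρj := hρpos j
        calc (∫ x, χ x (ρ j • v) ^ 2 ∂μ) / (t * (ρ j * 2 ^ j)) ^ 2
            ≤ η * (ρ j * (1 + √p)) ^ 2 / (t * (ρ j * 2 ^ j)) ^ 2 := by gcongr
          _ = η * (1 + √p) ^ 2 / t ^ 2 / (2 ^ j) ^ 2 := by
              field_simp
          _ ≤ η * (1 + √p) ^ 2 / t ^ 2 / 2 ^ j := by
              refine div_le_div_of_nonneg_left (by positivity) (by positivity) ?_
              exact le_self_pow₀ (one_le_pow₀ (by norm_num)) (by omega)
    refine (measure_biUnion_finset_le _ _).trans ((Finset.sum_le_sum hone).trans (le_of_eq ?_))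
    rw [Finset.sum_const, nsmul_eq_mul, ← ENNReal.ofReal_natCast,
      ← ENNReal.ofReal_mul (Nat.cast_nonneg _)]
    congr 1
    ring
  set bad : ℕ → Set (Fin n → 𝒵) := fun j =>
    if ρ j ≤ 2 * δ then bad1 j ∪ bad2 j else ∅ with hbad
  set A : ℝ := ε * tailConst p σ + F.card * (η * (1 + √p) ^ 2 / t ^ 2) with hA
  have hA0 : 0 ≤ A := by have := tailConst_pos p σ; positivity
  have hPbad : ∀ j, π (bad j) ≤ ENNReal.ofReal (2 * A / 2 / 2 ^ j) := by
    intro j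
    by_cases hj : ρ j ≤ 2 * δ
    · simp only [hbad, if_pos hj]
      refine (measure_union_le _ _).trans ((add_le_add (hP1 j hj) (hP2 j hj)).trans ?_)
      rw [← ENNReal.ofReal_add (by have := tailConst_pos p σ; positivity) (by positivity),
        mul_div_cancel_left₀ _ (two_ne_zero' ℝ), hA, add_div]
    · simp [hbad, if_neg hj]
  have hsum : π (⋃ j, bad j) ≤ ENNReal.ofReal (2 * A) := by
    refine (measure_iUnion_le _).trans ((ENNReal.tsum_le_tsum hPbad).trans ?_)
    rw [← ENNReal.ofReal_tsum_of_nonneg (fun i => by positivity) (summable_geometric_two' _),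
      tsum_geometric_two']
  refine le_trans (measure_mono ?_) hsum
  rintro z ⟨h, hh, hlt⟩
  by_contra hgood
  have hgood' : ∀ j, z ∉ bad j := fun j hj => hgood (Set.mem_iUnion.2 ⟨j, hj⟩)
  -- `j` is the shell of `h`
  have hex : ∃ j, ‖h‖ ≤ ρ j := by
    obtain ⟨j, hj⟩ := pow_unbounded_of_one_lt (‖h‖ * √(n : ℝ)) (one_lt_two)
    exact ⟨j, by rw [hρ, le_div_iff₀ hsn]; exact hj.le⟩
  classical
  set j := Nat.find hex with hj
  have hjle : ‖h‖ ≤ ρ j := Nat.find_spec hex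
  have hmain : ρ j ≤ 2 * δ ∧
      ρ j * 2 ^ j ≤ 4 * (√(n : ℝ) * ‖h‖ ^ 2 + 1 / √(n : ℝ)) := by
    rcases Nat.eq_zero_or_pos j with hj0 | hjpos
    · rw [hj0]
      simp only [hρ, pow_zero, mul_one]
      refine ⟨hnδ, ?_⟩
      have h1 : 0 ≤ √(n : ℝ) * ‖h‖ ^ 2 := by positivity
      have h2 : 0 ≤ 1 / √(n : ℝ) := by positivity
      linarith
    · have hlt' : ρ (j - 1) < ‖h‖ := not_le.1 (Nat.find_min hex (by omega))
      have hρj : ρ j = 2 * ρ (j - 1) := by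
        simp only [hρ]
        conv_lhs => rw [show j = (j - 1) + 1 by omega, pow_succ]
        ring
      have h1 : ρ j < 2 * ‖h‖ := by linarith
      refine ⟨by linarith, ?_⟩
      have h2 : ρ j * 2 ^ j = √(n : ℝ) * ρ j ^ 2 := by
        simp only [hρ]
        field_simp
      have h3 : ρ j ^ 2 ≤ (2 * ‖h‖) ^ 2 := pow_le_pow_left₀ (hρpos j).le h1.le 2
      have h4 : 0 ≤ 1 / √(n : ℝ) := by positivity
      rw [h2]
      nlinarith [mul_le_mul_of_nonneg_left h3 hsn.le]
  obtain ⟨hj2, hj3⟩ := hmain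
  have hnb := hgood' j
  simp only [hbad, if_pos hj2, Set.mem_union, not_or] at hnb
  obtain ⟨hnb1, hnb2⟩ := hnb
  set u : EuclideanSpace ℝ (Fin p) := (ρ j)⁻¹ • h with hu
  have hρu : ρ j • u = h := by rw [hu, smul_smul, mul_inv_cancel₀ (hρpos j).ne', one_smul]
  have hu1 : ‖u‖ ≤ 1 := by
    rw [hu, norm_smul, norm_inv, Real.norm_eq_abs, abs_of_pos (hρpos j), inv_mul_le_iff₀ (hρpos j)]
    linarith
  obtain ⟨v, hvF, hv⟩ : ∃ v ∈ F, |X j u z - X j v z| ≤ t := by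
    by_contra hcon
    push Not at hcon
    exact hnb1 ⟨u, hu1, hcon⟩
  have hv2 : |X j v z| < t := by
    by_contra hcon
    exact hnb2 (Set.mem_biUnion hvF (not_lt.1 hcon))
  have hXu : |X j u z| ≤ 2 * t := by
    have := abs_sub_abs_le_abs_sub (X j u z) (X j v z)
    linarith
  have hpos : 0 < ρ j * 2 ^ j := mul_pos (hρpos j) (by positivity)
  simp only [hX, hρu] at hXu
  rw [abs_div, abs_of_pos hpos, div_le_iff₀ hpos] at hXu
  nlinarith [mul_le_mul_of_nonneg_left hj3 (by positivity : (0 : ℝ) ≤ 2 * t)]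

/-- Stochastic differentiability: if `φ(Z, ·)` is Lipschitz near `0` with a square integrable
coefficient and `E φ(Z, h)² = o(‖h‖²)`, then `|Gₙ φ(·, h)| ≤ ε (√n ‖h‖² + 1/√n)` uniformly in a
neighborhood of `0`, with probability close to one. Both the rate of convergence and the
linearization of an M-estimator follow from this bound. -/
theorem stochastic_differentiability {φ : 𝒵 → EuclideanSpace ℝ (Fin p) → ℝ} {r : ℝ} (hr : 0 < r)
    (hm : ∀ h, ‖h‖ ≤ r → AEStronglyMeasurable (fun z => φ z h) μ)
    (h0 : ∀ z, φ z 0 = 0) {L : 𝒵 → ℝ} (hLm : Measurable L) (hL0 : ∀ z, 0 ≤ L z)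
    (hL : MemLp L 2 μ)
    (hlip : ∀ᵐ z ∂μ, ∀ h h', ‖h‖ ≤ r → ‖h'‖ ≤ r → |φ z h - φ z h'| ≤ L z * ‖h - h'‖)
    (hsmall : (fun h => ∫ z, φ z h ^ 2 ∂μ) =o[𝓝 0] fun h => ‖h‖ ^ 2)
    {ε : ℝ} (hε : 0 < ε) :
    ∃ δ > 0, ∀ᶠ n : ℕ in atTop, (Measure.pi fun _ : Fin n => μ) {z | ∃ h, ‖h‖ ≤ δ ∧
        ε * (√(n : ℝ) * ‖h‖ ^ 2 + 1 / √(n : ℝ)) < |empFluct μ (fun x => φ x h) z|}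
      ≤ ENNReal.ofReal ε := by
  set t : ℝ := ε / 16 with ht
  have htpos : 0 < t := by positivity
  set σ : ℝ := ∫ z, L z ^ 2 ∂μ with hσ
  have hB := tailConst_pos p σ
  set ε₁ : ℝ := ε / (8 * tailConst p σ) with hε₁
  have hε₁pos : 0 < ε₁ := by positivity
  obtain ⟨F, hF1, hF⟩ := exists_finset_chaining p htpos hε₁pos
  have hp1 : (0 : ℝ) < 1 + √p := by positivity
  set a : ℝ := F.card * ((1 + √p) ^ 2 / t ^ 2) + 1 with ha
  have hapos : 0 < a := by positivity
  set η : ℝ := ε / (8 * a) with hη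
  have hηpos : 0 < η := by positivity
  obtain ⟨r', hr'pos, hr'r, hr'⟩ : ∃ r' > 0, r' ≤ r ∧
      ∀ h : EuclideanSpace ℝ (Fin p), ‖h‖ ≤ r' → ∫ z, φ z h ^ 2 ∂μ ≤ η * ‖h‖ ^ 2 := by
    have h1 := hsmall.def hηpos
    rw [Metric.eventually_nhds_iff] at h1
    obtain ⟨r₁, hr₁, h1⟩ := h1
    refine ⟨min r (r₁ / 2), by positivity, min_le_left _ _, fun h hh => ?_⟩
    have hlt : dist h 0 < r₁ := by
      rw [dist_zero_right]
      have := hh.trans (min_le_right _ _)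
      linarith
    have h2 := h1 hlt
    rw [Real.norm_eq_abs, Real.norm_eq_abs, abs_of_nonneg (sq_nonneg ‖h‖)] at h2
    exact (le_abs_self _).trans h2
  set δ : ℝ := r' / (2 * (1 + √p)) with hδ
  have hδpos : 0 < δ := by positivity
  have hδr : 2 * δ * (1 + √p) ≤ r' := by
    rw [hδ]; field_simp; exact le_rfl
  have hδr' : δ ≤ r' := by
    have : 0 ≤ √(p : ℝ) := Real.sqrt_nonneg _
    nlinarith
  refine ⟨δ, hδpos, ?_⟩
  have hsqrt : Tendsto (fun n : ℕ => √(n : ℝ)) atTop atTop :=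
    Real.tendsto_sqrt_atTop.comp tendsto_natCast_atTop_atTop
  have hev1 : ∀ᶠ n : ℕ in atTop, 1 / (2 * δ) ≤ √(n : ℝ) := hsqrt.eventually_ge_atTop _
  have hev2 := (tendsto_integral_sq_indicator_sqrt_lt hLm hL).eventually_lt_const
    (half_pos hε)
  filter_upwards [hev1, hev2, eventually_gt_atTop 0] with n hn1 hn2 hn
  have hn' : (0 : ℝ) < n := by exact_mod_cast hn
  have hsn : 0 < √(n : ℝ) := Real.sqrt_pos.2 hn'
  set T : Set 𝒵 := {z | √(n : ℝ) < L z} with hT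
  have hTm : MeasurableSet T := measurableSet_lt measurable_const hLm
  set τ : ℝ := ∫ z, T.indicator (fun z => L z ^ 2) z ∂μ with hτ
  have hτint : Integrable (T.indicator (fun z => L z ^ 2)) μ := hL.integrable_sq.indicator hTm
  have hτ0 : 0 ≤ τ := integral_nonneg fun z => Set.indicator_nonneg (fun _ _ => sq_nonneg _) _
  set χ : 𝒵 → EuclideanSpace ℝ (Fin p) → ℝ := fun z h => Tᶜ.indicator (fun z => φ z h) z with hχ
  set ℓ : 𝒵 → ℝ := Tᶜ.indicator L with hℓ
  set π := Measure.pi fun _ : Fin n => μ with hπ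
  have hφL : ∀ h, ‖h‖ ≤ r → ∀ᵐ z ∂μ, |φ z h| ≤ L z * ‖h‖ := by
    intro h hh
    filter_upwards [hlip] with z hz
    simpa [h0] using hz h 0 hh (by simpa using hr.le)
  have hφL2 : ∀ h, ‖h‖ ≤ r → MemLp (fun z => φ z h) 2 μ := fun h hh =>
    (hL.mul_const ‖h‖).of_le (hm h hh) ((hφL h hh).mono fun z hz => hz.trans (le_abs_self _))
  have hφI : ∀ h, ‖h‖ ≤ r → Integrable (fun z => φ z h) μ := fun h hh =>
    (hφL2 h hh).integrable (by norm_num)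
  have hpeel := empFluct_peeling (μ := μ) hn (χ := χ) (r := r') (ℓ := ℓ) (σ := σ) (η := η)
    (t := t) (ε := ε₁) (F := F) (δ := δ)
    (fun h hh => (hm h (hh.trans hr'r)).indicator hTm.compl) hr'pos.le
    (fun z => by simp [hχ, h0, Set.indicator])
    (hLm.indicator hTm.compl).aestronglyMeasurable
    (fun z => Set.indicator_nonneg (fun z _ => hL0 z) z)
    (fun z => by
      by_cases hz : z ∈ T
      · simp [hℓ, hz]
      · rw [hℓ, Set.indicator_of_mem (by exact hz)]
        simpa [hT] using hz)
    (by
      refine integral_mono_of_nonneg (Eventually.of_forall fun z => sq_nonneg _) hL.integrable_sq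
        (Eventually.of_forall fun z => ?_)
      by_cases hz : z ∈ T
      · simp [hℓ, hz, sq_nonneg]
      · simp [hℓ, hz])
    (by
      filter_upwards [hlip] with z hz h h' hh hh'
      by_cases hzT : z ∈ T
      · simp [hχ, hℓ, hzT]
      · simpa [hχ, hℓ, hzT] using hz h h' (hh.trans hr'r) (hh'.trans hr'r))
    hηpos.le
    (fun h hh => by
      refine le_trans (integral_mono_of_nonneg (Eventually.of_forall fun z => sq_nonneg _)
        (hφL2 h (hh.trans hr'r)).integrable_sq (Eventually.of_forall fun z => ?_)) (hr' h hh)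
      by_cases hz : z ∈ T
      · simp [hχ, hz, sq_nonneg]
      · simp [hχ, hz])
    htpos hε₁pos hF1 (fun X B => hF _ X B) hδr
    (by
      rw [div_le_iff₀ (by positivity)] at hn1 ⊢
      linarith)
  -- with high probability no observation is truncated
  have hbig : π {z | ∃ i, z i ∈ T} ≤ ENNReal.ofReal τ := by
    have h1 : μ T ≤ ENNReal.ofReal (τ / n) := by
      rw [← ofReal_measureReal]
      refine ENNReal.ofReal_le_ofReal ?_
      rw [le_div_iff₀ hn']
      calc μ.real T * n = ∫ z, T.indicator (fun _ => (n : ℝ)) z ∂μ := by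
            rw [integral_indicator hTm]; simp
        _ ≤ τ := by
            refine integral_mono ((integrable_const _).indicator hTm) hτint fun z => ?_
            by_cases hz : z ∈ T
            · simp only [Set.indicator_of_mem hz]
              exact (Real.sqrt_le_left (hL0 z)).1 (le_of_lt hz)
            · simp [hz]
    have h2 : {z : Fin n → 𝒵 | ∃ i, z i ∈ T} = ⋃ i, Function.eval i ⁻¹' T := by
      ext z; simp
    rw [h2]
    refine (measure_iUnion_le _).trans ?_
    have h3 : ∀ i : Fin n, π (Function.eval i ⁻¹' T) = μ T := fun i =>
      (measurePreserving_eval (fun _ : Fin n => μ) i).measure_preimage hTm.nullMeasurableSet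
    simp only [h3, tsum_fintype, Finset.sum_const, Finset.card_univ, Fintype.card_fin,
      nsmul_eq_mul]
    refine (mul_le_mul_right h1 _).trans ?_
    rw [← ENNReal.ofReal_natCast, ← ENNReal.ofReal_mul (Nat.cast_nonneg _)]
    refine ENNReal.ofReal_le_ofReal (le_of_eq ?_)
    field_simp
  -- the effect of the truncation on the centering
  have hcenter : ∀ h, ‖h‖ ≤ r → √(n : ℝ) * |∫ z, φ z h ∂μ - ∫ z, χ z h ∂μ| ≤ τ * ‖h‖ := by
    intro h hh
    have h1 : ∫ z, φ z h ∂μ - ∫ z, χ z h ∂μ = ∫ z, T.indicator (fun z => φ z h) z ∂μ := by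
      rw [← integral_sub (hφI h hh) ((hφI h hh).indicator hTm.compl)]
      congr 1; ext z
      by_cases hz : z ∈ T <;> simp [hz]
    rw [h1, hτ, ← integral_mul_const, ← Real.norm_eq_abs, ← le_div_iff₀' hsn, ← integral_div]
    refine norm_integral_le_of_norm_le ((hτint.mul_const _).div_const _) ?_
    filter_upwards [hφL h hh] with z hz
    by_cases hzT : z ∈ T
    · simp only [Set.indicator_of_mem hzT]
      rw [le_div_iff₀ hsn, Real.norm_eq_abs]
      have h2 : √(n : ℝ) ≤ L z := le_of_lt hzT
      calc |φ z h| * √(n : ℝ) ≤ (L z * ‖h‖) * L z := by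
            gcongr
            exact (abs_nonneg _).trans hz
        _ = L z ^ 2 * ‖h‖ := by ring
    · simp [hzT]
  have hsub : {z : Fin n → 𝒵 | ∃ h, ‖h‖ ≤ δ ∧
        ε * (√(n : ℝ) * ‖h‖ ^ 2 + 1 / √(n : ℝ)) < |empFluct μ (fun x => φ x h) z|}
      ⊆ {z | ∃ i, z i ∈ T} ∪ {z | ∃ h, ‖h‖ ≤ δ ∧
        8 * t * (√(n : ℝ) * ‖h‖ ^ 2 + 1 / √(n : ℝ)) < |empFluct μ (fun x => χ x h) z|} := by
    rintro z ⟨h, hh, hlt⟩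
    by_cases hz : ∃ i, z i ∈ T
    · exact Or.inl hz
    refine Or.inr ⟨h, hh, ?_⟩
    push Not at hz
    have hhr : ‖h‖ ≤ r := hh.trans (hδr'.trans hr'r)
    have heq : empFluct μ (fun x => φ x h) z
        = empFluct μ (fun x => χ x h) z - √(n : ℝ) * (∫ z, φ z h ∂μ - ∫ z, χ z h ∂μ) := by
      have h1 : ∀ i, χ (z i) h = φ (z i) h := fun i => by simp [hχ, hz i]
      simp only [empFluct, h1, Finset.sum_sub_distrib, Finset.sum_const, Finset.card_univ,
        Fintype.card_fin, nsmul_eq_mul]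
      have h2 : (n : ℝ) = √(n : ℝ) * √(n : ℝ) := (Real.mul_self_sqrt hn'.le).symm
      generalize √(n : ℝ) = y at hsn h2 ⊢
      rw [h2]
      field_simp
      ring
    have h1 : |empFluct μ (fun x => φ x h) z|
        ≤ |empFluct μ (fun x => χ x h) z| + τ * ‖h‖ := by
      rw [heq]
      refine (abs_sub _ _).trans ?_
      rw [abs_mul, abs_of_pos hsn]
      linarith [hcenter h hhr]
    have h2 : 2 * ‖h‖ ≤ √(n : ℝ) * ‖h‖ ^ 2 + 1 / √(n : ℝ) := by
      have h3 : √(n : ℝ) * ‖h‖ ^ 2 + 1 / √(n : ℝ) - 2 * ‖h‖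
          = (√(n : ℝ) * ‖h‖ - 1) ^ 2 / √(n : ℝ) := by
        field_simp
        ring
      have h4 : 0 ≤ (√(n : ℝ) * ‖h‖ - 1) ^ 2 / √(n : ℝ) := by positivity
      linarith
    have h5 : τ * ‖h‖ ≤ ε / 2 * ‖h‖ := mul_le_mul_of_nonneg_right hn2.le (norm_nonneg _)
    have h6 := mul_le_mul_of_nonneg_left h2 (by positivity : 0 ≤ ε / 2)
    have h7 : 0 ≤ ε / 2 * ‖h‖ := by positivity
    have h8 : 8 * t = ε / 2 := by rw [ht]; ring
    rw [h8]
    linarith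
  refine (measure_mono hsub).trans ((measure_union_le _ _).trans ((add_le_add hbig hpeel).trans ?_))
  rw [← ENNReal.ofReal_add hτ0 (by positivity)]
  refine ENNReal.ofReal_le_ofReal ?_
  have e1 : ε₁ * tailConst p σ = ε / 8 := by rw [hε₁]; field_simp
  have e2 : F.card * (η * (1 + √p) ^ 2 / t ^ 2) ≤ ε / 8 := by
    have : F.card * (η * (1 + √p) ^ 2 / t ^ 2) = η * (a - 1) := by rw [ha]; ring
    rw [this]
    have h3 : η * a = ε / 8 := by rw [hη]; field_simp
    linarith
  linarith

end StochasticDifferentiability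

/-! ### The gradient of the loss -/

section Gradient

variable {𝒵 : Type*} [MeasurableSpace 𝒵] {μ : Measure 𝒵} {p : ℕ}
  {f : 𝒵 → EuclideanSpace ℝ (Fin p) → ℝ} {g : 𝒵 → EuclideanSpace ℝ (Fin p)}
  {θ : EuclideanSpace ℝ (Fin p)}

/-- Along every sequence of increments tending to `0`, the first order remainder of `f(Z, ·)` at
`θ` with gradient `g(Z)` is almost surely `o(‖h‖)` after passing to a subsequence. This is a common
consequence of almost sure differentiability and of differentiability in probability. -/
def HasGradientAlongSubseqAt (μ : Measure 𝒵) (f : 𝒵 → EuclideanSpace ℝ (Fin p) → ℝ)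
    (g : 𝒵 → EuclideanSpace ℝ (Fin p)) (θ : EuclideanSpace ℝ (Fin p)) : Prop :=
  ∀ hs : ℕ → EuclideanSpace ℝ (Fin p), Tendsto hs atTop (𝓝[≠] 0) →
    ∃ ns : ℕ → ℕ, Tendsto ns atTop atTop ∧ ∀ᵐ z ∂μ, Tendsto (fun k =>
      (f z (θ + hs (ns k)) - f z θ - inner ℝ (g z) (hs (ns k))) / ‖hs (ns k)‖) atTop (𝓝 0)

lemma HasGradientInProbabilityAt.alongSubseq (h : HasGradientInProbabilityAt μ f g θ) :
    HasGradientAlongSubseqAt μ f g θ := by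
  intro hs hhs
  exact (TendstoInMeasure.comp h hhs).exists_seq_tendsto_ae'

lemma hasGradientAlongSubseqAt_of_ae (h : ∀ᵐ z ∂μ, HasGradientAt (f z) (g z) θ) :
    HasGradientAlongSubseqAt μ f g θ := by
  intro hs hhs
  refine ⟨id, tendsto_id, ?_⟩
  filter_upwards [h] with z hz
  rw [hasGradientAt_iff_isLittleO_nhds_zero] at hz
  exact hz.norm_right.tendsto_div_nhds_zero.comp (tendsto_nhds_of_tendsto_nhdsWithin hhs)

lemma HasGradientAlongSubseqAt.congr {g' : 𝒵 → EuclideanSpace ℝ (Fin p)}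
    (h : HasGradientAlongSubseqAt μ f g θ) (hg : g =ᵐ[μ] g') :
    HasGradientAlongSubseqAt μ f g' θ := by
  intro hs hhs
  obtain ⟨ns, hns, hae⟩ := h hs hhs
  refine ⟨ns, hns, ?_⟩
  filter_upwards [hae, hg] with z hz hgz
  rwa [← hgz]

/-- The coordinates of the gradient are almost sure limits of difference quotients. -/
lemma HasGradientAlongSubseqAt.exists_seq_coord (h : HasGradientAlongSubseqAt μ f g θ) {r : ℝ}
    (hr : 0 < r) (i : Fin p) :
    ∃ t : ℕ → ℝ, (∀ k, 0 < t k ∧ t k ≤ r) ∧ ∀ᵐ z ∂μ, Tendsto (fun k =>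
      (f z (θ + t k • EuclideanSpace.single i 1) - f z θ) / t k) atTop (𝓝 (g z i)) := by
  set s : ℕ → ℝ := fun k => r * (1 / ((k : ℝ) + 1)) with hs
  have hspos : ∀ k, 0 < s k := fun k => by positivity
  have hsle : ∀ k, s k ≤ r := fun k => by
    have : 1 / ((k : ℝ) + 1) ≤ 1 := by
      rw [div_le_one (by positivity)]
      linarith [(Nat.cast_nonneg k : (0 : ℝ) ≤ k)]
    simp only [hs]
    nlinarith
  have hs0 : Tendsto s atTop (𝓝 0) := by
    rw [← mul_zero r]
    exact (tendsto_one_div_add_atTop_nhds_zero_nat (𝕜 := ℝ)).const_mul r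
  set e : EuclideanSpace ℝ (Fin p) := EuclideanSpace.single i 1 with he
  have hne : ‖e‖ = 1 := by simp [he]
  have hnorm : ∀ k, ‖s k • e‖ = s k := fun k => by
    rw [norm_smul, hne, mul_one, Real.norm_eq_abs, abs_of_pos (hspos k)]
  obtain ⟨ns, hns, hae⟩ := h (fun k => s k • e) (by
    refine tendsto_nhdsWithin_iff.2 ⟨?_, Eventually.of_forall fun k => ?_⟩
    · simpa using hs0.smul_const e
    · rw [Set.mem_compl_singleton_iff, ← norm_ne_zero_iff, hnorm]
      exact (hspos k).ne')
  refine ⟨fun k => s (ns k), fun k => ⟨hspos _, hsle _⟩, ?_⟩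
  filter_upwards [hae] with z hz
  have h1 := hz.add_const (g z i)
  rw [zero_add] at h1
  refine h1.congr fun k => ?_
  have hin : inner ℝ (g z) e = g z i := by
    rw [he, EuclideanSpace.inner_single_right]; simp
  rw [hnorm, inner_smul_right, hin]
  have := (hspos (ns k)).ne'
  field_simp
  ring

variable {r : ℝ}

lemma HasGradientAlongSubseqAt.aemeasurable (h : HasGradientAlongSubseqAt μ f g θ) (hr : 0 < r)
    (hm : ∀ h, ‖h‖ ≤ r → Measurable fun z => f z (θ + h)) : AEMeasurable g μ := by
  have hcoord : ∀ i, AEMeasurable (fun z => g z i) μ := by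
    intro i
    obtain ⟨t, ht, hae⟩ := h.exists_seq_coord hr i
    refine aemeasurable_of_tendsto_metrizable_ae atTop (fun k => Measurable.aemeasurable ?_) hae
    have h0 : Measurable fun z => f z θ := by simpa using hm 0 (by simpa using hr.le)
    refine Measurable.div_const (Measurable.sub (hm _ ?_) h0) _
    rw [norm_smul, PiLp.norm_single, norm_one, mul_one, Real.norm_eq_abs,
      abs_of_pos (ht k).1]
    exact (ht k).2
  have h1 : AEMeasurable (fun z i => g z i) μ := aemeasurable_pi_lambda _ hcoord
  exact (PiLp.continuous_toLp 2 _).measurable.comp_aemeasurable h1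

/-- The gradient is bounded by the Lipschitz coefficient, up to a dimensional constant. -/
lemma HasGradientAlongSubseqAt.norm_le (h : HasGradientAlongSubseqAt μ f g θ) (hr : 0 < r)
    {L : 𝒵 → ℝ} (hL0 : ∀ z, 0 ≤ L z)
    (hlip : ∀ᵐ z ∂μ, ∀ h h', ‖h‖ ≤ r → ‖h'‖ ≤ r →
      |f z (θ + h) - f z (θ + h')| ≤ L z * ‖h - h'‖) :
    ∀ᵐ z ∂μ, ‖g z‖ ≤ √p * L z := by
  have hcoord : ∀ i, ∀ᵐ z ∂μ, |g z i| ≤ L z := by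
    intro i
    obtain ⟨t, ht, hae⟩ := h.exists_seq_coord hr i
    filter_upwards [hae, hlip] with z hz hl
    refine le_of_tendsto hz.abs (Eventually.of_forall fun k => ?_)
    have hn : ‖t k • (EuclideanSpace.single i 1 : EuclideanSpace ℝ (Fin p))‖ = t k := by
      rw [norm_smul, PiLp.norm_single, norm_one, mul_one, Real.norm_eq_abs,
        abs_of_pos (ht k).1]
    have := hl (t k • EuclideanSpace.single i 1) 0 (hn.le.trans (ht k).2) (by simpa using hr.le)
    rw [add_zero, sub_zero, hn] at this
    rwa [abs_div, abs_of_pos (ht k).1, div_le_iff₀ (ht k).1]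
  filter_upwards [ae_all_iff.2 hcoord] with z hz
  rw [EuclideanSpace.norm_eq]
  refine Real.sqrt_le_iff.2 ⟨mul_nonneg (Real.sqrt_nonneg _) (hL0 z), ?_⟩
  rw [mul_pow, Real.sq_sqrt (Nat.cast_nonneg p)]
  calc ∑ i, ‖g z i‖ ^ 2 ≤ ∑ _i : Fin p, L z ^ 2 := by
        refine Finset.sum_le_sum fun i _ => ?_
        rw [Real.norm_eq_abs]
        exact pow_le_pow_left₀ (abs_nonneg _) (hz i) 2
    _ = p * L z ^ 2 := by simp

/-- The first order remainder `f(z, θ + h) - f(z, θ) - g(z)'h` of the loss. -/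
noncomputable def lossRemainder (f : 𝒵 → EuclideanSpace ℝ (Fin p) → ℝ)
    (g : 𝒵 → EuclideanSpace ℝ (Fin p)) (θ : EuclideanSpace ℝ (Fin p)) (z : 𝒵)
    (h : EuclideanSpace ℝ (Fin p)) : ℝ :=
  f z (θ + h) - f z θ - inner ℝ (g z) h

lemma lossRemainder_zero {𝒳 : Type*} {f : 𝒳 → EuclideanSpace ℝ (Fin p) → ℝ}
    {g : 𝒳 → EuclideanSpace ℝ (Fin p)} (z : 𝒳) : lossRemainder f g θ z 0 = 0 := by simp [lossRemainder]

lemma measurable_lossRemainder (hr : 0 ≤ r) (hg : Measurable g)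
    (hm : ∀ h, ‖h‖ ≤ r → Measurable fun z => f z (θ + h)) (h : EuclideanSpace ℝ (Fin p))
    (hh : ‖h‖ ≤ r) : Measurable fun z => lossRemainder f g θ z h := by
  have h0 : Measurable fun z => f z θ := by simpa using hm 0 (by simpa using hr)
  exact ((hm h hh).sub h0).sub (hg.inner_const)

lemma lossRemainder_lipschitz {L : 𝒵 → ℝ}
    (hlip : ∀ᵐ z ∂μ, ∀ h h', ‖h‖ ≤ r → ‖h'‖ ≤ r →
      |f z (θ + h) - f z (θ + h')| ≤ L z * ‖h - h'‖) :
    ∀ᵐ z ∂μ, ∀ h h', ‖h‖ ≤ r → ‖h'‖ ≤ r →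
      |lossRemainder f g θ z h - lossRemainder f g θ z h'| ≤ (L z + ‖g z‖) * ‖h - h'‖ := by
  filter_upwards [hlip] with z hz h h' hh hh'
  have e : lossRemainder f g θ z h - lossRemainder f g θ z h'
      = (f z (θ + h) - f z (θ + h')) - inner ℝ (g z) (h - h') := by
    simp only [lossRemainder, inner_sub_right]; ring
  rw [e, add_mul]
  exact (abs_sub _ _).trans (add_le_add (hz h h' hh hh') (abs_real_inner_le_norm _ _))

/-- The first order remainder is `o(‖h‖)` in quadratic mean, by dominated convergence. -/
lemma HasGradientAlongSubseqAt.isLittleO_integral_sq (hgrad : HasGradientAlongSubseqAt μ f g θ)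
    (hr : 0 < r) (hg : Measurable g)
    (hm : ∀ h, ‖h‖ ≤ r → Measurable fun z => f z (θ + h)) {L : 𝒵 → ℝ}
    (hL0 : ∀ z, 0 ≤ L z) (hL : MemLp (fun z => L z + ‖g z‖) 2 μ)
    (hlip : ∀ᵐ z ∂μ, ∀ h h', ‖h‖ ≤ r → ‖h'‖ ≤ r →
      |f z (θ + h) - f z (θ + h')| ≤ L z * ‖h - h'‖) :
    (fun h => ∫ z, lossRemainder f g θ z h ^ 2 ∂μ) =o[𝓝 0] fun h => ‖h‖ ^ 2 := by
  have hlim : Tendsto (fun h : EuclideanSpace ℝ (Fin p) =>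
      ∫ z, (lossRemainder f g θ z h / ‖h‖) ^ 2 ∂μ) (𝓝[≠] 0) (𝓝 0) := by
    refine tendsto_of_subseq_tendsto fun hs hhs => ?_
    obtain ⟨ns, hns, hae⟩ := hgrad hs hhs
    refine ⟨ns, ?_⟩
    have hhs' := hhs.comp hns
    have hball : ∀ᶠ k in atTop, ‖hs (ns k)‖ ≤ r := by
      have := (tendsto_nhds_of_tendsto_nhdsWithin hhs').eventually
        (Metric.closedBall_mem_nhds (0 : EuclideanSpace ℝ (Fin p)) hr)
      filter_upwards [this] with k hk
      simpa using hk
    rw [← integral_zero 𝒵 ℝ (μ := μ)]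
    refine tendsto_integral_filter_of_dominated_convergence (fun z => (L z + ‖g z‖) ^ 2) ?_ ?_
      hL.integrable_sq ?_
    · filter_upwards [hball] with k hk
      exact (((measurable_lossRemainder hr.le hg hm _ hk).div_const _).pow_const 2
        ).aestronglyMeasurable
    · filter_upwards [hball] with k hk
      filter_upwards [lossRemainder_lipschitz (g := g) hlip] with z hz
      have h1 := hz (hs (ns k)) 0 hk (by simpa using hr.le)
      rw [lossRemainder_zero, sub_zero, sub_zero] at h1
      rw [Real.norm_eq_abs, abs_of_nonneg (sq_nonneg _), ← sq_abs, abs_div, abs_norm]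
      refine pow_le_pow_left₀ (by positivity) ?_ 2
      rcases (norm_nonneg (hs (ns k))).eq_or_lt with h0 | hpos
      · rw [← h0, div_zero]
        simpa using add_nonneg (hL0 z) (norm_nonneg (g z))
      · rwa [div_le_iff₀ hpos]
    · filter_upwards [hae] with z hz
      simpa [lossRemainder] using hz.pow 2
  refine IsLittleO.of_bound fun c hc => ?_
  have h1 := hlim.eventually_lt_const hc
  rw [eventually_nhdsWithin_iff] at h1
  filter_upwards [h1] with h hh
  rcases eq_or_ne h 0 with rfl | hne
  · simp [lossRemainder_zero]
  · have h2 := hh hne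
    have hpos : 0 < ‖h‖ ^ 2 := pow_pos (norm_pos_iff.2 hne) 2
    simp only [div_pow] at h2
    rw [integral_div, div_lt_iff₀ hpos] at h2
    rw [Real.norm_eq_abs, Real.norm_eq_abs, abs_of_pos hpos,
      abs_of_nonneg (integral_nonneg fun z => sq_nonneg _)]
    exact h2.le

/-! ### The expansion of the population risk -/

lemma populationRisk_toReal_sub (hr : 0 ≤ r) (hfin : populationRisk μ f θ ≠ ⊤)
    (hm : ∀ h, ‖h‖ ≤ r → Measurable fun z => f z (θ + h))
    (hnn : ∀ h, ‖h‖ ≤ r → ∀ z, 0 ≤ f z (θ + h)) {L : 𝒵 → ℝ} (hL : Integrable L μ)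
    (hlip : ∀ᵐ z ∂μ, ∀ h h', ‖h‖ ≤ r → ‖h'‖ ≤ r →
      |f z (θ + h) - f z (θ + h')| ≤ L z * ‖h - h'‖)
    {h : EuclideanSpace ℝ (Fin p)} (hh : ‖h‖ ≤ r) :
    populationRisk μ f (θ + h) ≠ ⊤ ∧ Integrable (fun z => f z (θ + h) - f z θ) μ ∧
    (populationRisk μ f (θ + h)).toReal - (populationRisk μ f θ).toReal
      = ∫ z, (f z (θ + h) - f z θ) ∂μ := by
  have h0r : ‖(0 : EuclideanSpace ℝ (Fin p))‖ ≤ r := by simpa using hr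
  have hm0 : Measurable fun z => f z θ := by simpa using hm 0 h0r
  have hnn0 : ∀ z, 0 ≤ f z θ := by simpa using hnn 0 h0r
  have hdiff : Integrable (fun z => f z (θ + h) - f z θ) μ := by
    refine (hL.mul_const ‖h‖).mono' ((hm h hh).sub hm0).aestronglyMeasurable ?_
    filter_upwards [hlip] with z hz
    simpa using hz h 0 hh h0r
  have hI0 : Integrable (fun z => f z θ) μ := by
    refine ⟨hm0.aestronglyMeasurable, ?_⟩
    rw [hasFiniteIntegral_iff_ofReal (Eventually.of_forall hnn0)]
    exact lt_top_iff_ne_top.2 hfin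
  have hIh : Integrable (fun z => f z (θ + h)) μ := by
    refine (hdiff.add hI0).congr (Eventually.of_forall fun z => ?_)
    simp
  have hfinh : populationRisk μ f (θ + h) ≠ ⊤ := by
    have := hIh.2
    rw [hasFiniteIntegral_iff_ofReal (Eventually.of_forall (hnn h hh))] at this
    exact this.ne
  refine ⟨hfinh, hdiff, ?_⟩
  rw [integral_sub hIh hI0, integral_eq_lintegral_of_nonneg_ae (Eventually.of_forall (hnn h hh))
    (hm h hh).aestronglyMeasurable, integral_eq_lintegral_of_nonneg_ae (Eventually.of_forall hnn0)
    hm0.aestronglyMeasurable]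
  rfl

end Gradient

section Hessian

variable {p : ℕ} {R : EuclideanSpace ℝ (Fin p) → ℝ} {V : Matrix (Fin p) (Fin p) ℝ}
  {θ : EuclideanSpace ℝ (Fin p)}

lemma dotProduct_mulVec_eq_inner (V : Matrix (Fin p) (Fin p) ℝ) (h : EuclideanSpace ℝ (Fin p)) :
    h.ofLp ⬝ᵥ (V *ᵥ h.ofLp) = inner ℝ h (Matrix.toEuclideanCLM (𝕜 := ℝ) V h) :=
  (Matrix.inner_toEuclideanCLM V h h).symm

lemma isBigO_inner_toEuclideanCLM (V : Matrix (Fin p) (Fin p) ℝ) :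
    (fun h : EuclideanSpace ℝ (Fin p) =>
      inner ℝ h (Matrix.toEuclideanCLM (𝕜 := ℝ) V h)) =O[𝓝 0] fun h => ‖h‖ ^ 2 := by
  refine IsBigO.of_bound ‖Matrix.toEuclideanCLM (𝕜 := ℝ) V‖ (Eventually.of_forall fun h => ?_)
  rw [Real.norm_eq_abs, Real.norm_eq_abs, abs_of_nonneg (sq_nonneg ‖h‖)]
  refine (abs_real_inner_le_norm _ _).trans ?_
  have := (Matrix.toEuclideanCLM (𝕜 := ℝ) V).le_opNorm h
  nlinarith [norm_nonneg h]

lemma isLittleO_norm_sq_id :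
    (fun h : EuclideanSpace ℝ (Fin p) => ‖h‖ ^ 2) =o[𝓝 0] fun h => h := by
  have := isLittleO_norm_pow_id (E' := EuclideanSpace ℝ (Fin p)) one_lt_two
  exact this

/-- At a local minimum the linear terms of both first order expansions of the risk vanish. -/
lemma HasSecondOrderTaylorAt.of_isLocalMin (hT : HasSecondOrderTaylorAt R V θ)
    (hmin : ∀ᶠ h in 𝓝 0, R θ ≤ R (θ + h)) :
    (fun h => R (θ + h) - R θ - (1 / 2) * inner ℝ h (Matrix.toEuclideanCLM (𝕜 := ℝ) V h))
      =o[𝓝 0] (fun h => ‖h‖ ^ 2) ∧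
    ∀ a : EuclideanSpace ℝ (Fin p),
      ((fun h => R (θ + h) - R θ - inner ℝ a h) =o[𝓝 0] fun h => h) → a = 0 := by
  have hlocal : IsLocalMin R θ := by
    have h1 : Tendsto (fun x => x - θ) (𝓝 θ) (𝓝 0) := by
      have : Continuous fun x : EuclideanSpace ℝ (Fin p) => x - θ := by fun_prop
      simpa using this.tendsto θ
    filter_upwards [h1.eventually hmin] with x hx
    simpa using hx
  have hzero : ∀ a : EuclideanSpace ℝ (Fin p),
      ((fun h => R (θ + h) - R θ - inner ℝ a h) =o[𝓝 0] fun h => h) → a = 0 := by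
    intro a ha
    have hd : HasFDerivAt R (innerSL ℝ a) θ := by
      rw [hasFDerivAt_iff_isLittleO_nhds_zero]
      simpa using ha
    have h0 := hlocal.hasFDerivAt_eq_zero hd
    have : innerSL ℝ a a = 0 := by rw [h0]; simp
    rw [innerSL_apply_apply] at this
    exact inner_self_eq_zero.1 this
  refine ⟨?_, hzero⟩
  obtain ⟨-, b, hb⟩ := hT
  simp only [dotProduct_mulVec_eq_inner] at hb
  have hb0 : b = 0 := by
    refine hzero b ?_
    have h1 := (hb.trans isLittleO_norm_sq_id).add
      (((isBigO_inner_toEuclideanCLM V).const_mul_left (1 / 2)).trans_isLittleO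
        isLittleO_norm_sq_id)
    refine h1.congr_left fun h => ?_
    ring
  refine hb.congr_left fun h => ?_
  rw [hb0, inner_zero_left, sub_zero]

lemma posSemidef_of_isLocalMin (hV : V.IsSymm)
    (hexp : (fun h => R (θ + h) - R θ - (1 / 2) * inner ℝ h (Matrix.toEuclideanCLM (𝕜 := ℝ) V h))
      =o[𝓝 0] (fun h => ‖h‖ ^ 2))
    (hmin : ∀ᶠ h in 𝓝 0, R θ ≤ R (θ + h)) : V.PosSemidef := by
  refine Matrix.PosSemidef.of_dotProduct_mulVec_nonneg (by
    rw [Matrix.IsHermitian, Matrix.conjTranspose_eq_transpose_of_trivial]; exact hV) ?_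
  intro x
  set u : EuclideanSpace ℝ (Fin p) := WithLp.toLp 2 x with hu
  have e : star x ⬝ᵥ V *ᵥ x = inner ℝ u (Matrix.toEuclideanCLM (𝕜 := ℝ) V u) := by
    rw [← dotProduct_mulVec_eq_inner]; simp [hu]
  rw [e]
  refine le_of_forall_pos_le_add fun c hc => ?_
  rcases eq_or_ne u 0 with h0 | hne
  · simp [h0, hc.le]
  have hpos : 0 < ‖u‖ ^ 2 := pow_pos (norm_pos_iff.2 hne) 2
  have h1 := (hexp.def (c := c / (2 * ‖u‖ ^ 2)) (by positivity)).and hmin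
  have ht : Tendsto (fun t : ℝ => t • u) (𝓝[>] 0) (𝓝 0) := by
    have : Continuous fun t : ℝ => t • u := by fun_prop
    simpa using (this.tendsto 0).mono_left nhdsWithin_le_nhds
  obtain ⟨t, ⟨ht1, ht2⟩, htpos⟩ := ((ht.eventually h1).and self_mem_nhdsWithin).exists
  have htpos : 0 < t := htpos
  have hn : ‖t • u‖ = t * ‖u‖ := by rw [norm_smul, Real.norm_eq_abs, abs_of_pos htpos]
  have hn2 : ‖(t * ‖u‖) ^ 2‖ = (t * ‖u‖) ^ 2 := by
    rw [Real.norm_eq_abs, abs_of_nonneg (sq_nonneg _)]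
  have h2 := (Real.le_norm_self _).trans ht1
  rw [hn, hn2, map_smul, inner_smul_left, inner_smul_right, conj_trivial] at h2
  have h3 : c / (2 * ‖u‖ ^ 2) * (t * ‖u‖) ^ 2 = t ^ 2 * (c / 2) := by field_simp
  have h4 : 0 < t ^ 2 := by positivity
  nlinarith

lemma exists_pos_forall_mul_norm_sq_le (hV : V.PosDef) :
    ∃ c > 0, ∀ h : EuclideanSpace ℝ (Fin p),
      c * ‖h‖ ^ 2 ≤ inner ℝ h (Matrix.toEuclideanCLM (𝕜 := ℝ) V h) := by
  set T := Matrix.toEuclideanCLM (𝕜 := ℝ) V with hT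
  have hpos : ∀ h : EuclideanSpace ℝ (Fin p), h ≠ 0 → 0 < inner ℝ h (T h) := by
    intro h hh
    rw [hT, ← dotProduct_mulVec_eq_inner]
    have := hV.dotProduct_mulVec_pos (x := h.ofLp) (by simpa using hh)
    simpa using this
  have hcont : Continuous fun h : EuclideanSpace ℝ (Fin p) => (inner ℝ h (T h) : ℝ) :=
    continuous_id.inner T.continuous
  rcases (Metric.sphere (0 : EuclideanSpace ℝ (Fin p)) 1).eq_empty_or_nonempty with hemp | hne
  · refine ⟨1, one_pos, fun h => ?_⟩
    rcases eq_or_ne h 0 with rfl | hh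
    · simp
    · exfalso
      have : ‖h‖⁻¹ • h ∈ Metric.sphere (0 : EuclideanSpace ℝ (Fin p)) 1 := by
        simp [norm_smul, inv_mul_cancel₀ (norm_ne_zero_iff.2 hh)]
      rw [hemp] at this
      exact this
  · obtain ⟨x, hx, hmin⟩ := (isCompact_sphere (0 : EuclideanSpace ℝ (Fin p)) 1).exists_isMinOn hne
      hcont.continuousOn
    have hx1 : ‖x‖ = 1 := by simpa using hx
    refine ⟨inner ℝ x (T x), hpos x (by rintro rfl; simp at hx1), fun h => ?_⟩
    rcases eq_or_ne h 0 with rfl | hh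
    · simp
    · have hnz : ‖h‖ ≠ 0 := norm_ne_zero_iff.2 hh
      have hmem : ‖h‖⁻¹ • h ∈ Metric.sphere (0 : EuclideanSpace ℝ (Fin p)) 1 := by
        simp [norm_smul, inv_mul_cancel₀ hnz]
      have h1 : inner ℝ x (T x) ≤ inner ℝ (‖h‖⁻¹ • h) (T (‖h‖⁻¹ • h)) := hmin hmem
      rw [map_smul, inner_smul_left, inner_smul_right, conj_trivial] at h1
      have h2 : 0 < ‖h‖ ^ 2 := by positivity
      calc inner ℝ x (T x) * ‖h‖ ^ 2
          ≤ (‖h‖⁻¹ * (‖h‖⁻¹ * inner ℝ h (T h))) * ‖h‖ ^ 2 := by gcongr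
        _ = inner ℝ h (T h) := by field_simp

/-- Two points that both nearly minimize a strongly convex quadratic are close: if `k₂` is its
exact minimizer and the perturbed value at `k₁` is at most the one at `k₂`, then `‖k₁ - k₂‖` is
controlled by the size of the perturbation. -/
lemma norm_sub_sq_le_of_perturbed_quadratic_le {T : EuclideanSpace ℝ (Fin p) →L[ℝ]
      EuclideanSpace ℝ (Fin p)} (hsymm : ∀ x y, inner ℝ (T x) y = (inner ℝ x (T y) : ℝ))
    {c : ℝ} (hc : ∀ h, c * ‖h‖ ^ 2 ≤ inner ℝ h (T h)) {S k₁ k₂ : EuclideanSpace ℝ (Fin p)}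
    (hk₂ : T k₂ = -S) {r₁ r₂ ε : ℝ} (hε : 0 ≤ ε) (hεc : 16 * ε ≤ c)
    (hr₁ : |r₁| ≤ ε * (2 * ‖k₁‖ ^ 2 + 1)) (hr₂ : |r₂| ≤ ε * (2 * ‖k₂‖ ^ 2 + 1))
    (hle : (1 / 2) * inner ℝ k₁ (T k₁) + inner ℝ S k₁ + r₁
      ≤ (1 / 2) * inner ℝ k₂ (T k₂) + inner ℝ S k₂ + r₂) :
    c * ‖k₁ - k₂‖ ^ 2 ≤ ε * (24 * ‖k₂‖ ^ 2 + 8) := by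
  have hS : S = -T k₂ := by rw [hk₂, neg_neg]
  have e : (1 / 2 : ℝ) * inner ℝ (k₁ - k₂) (T (k₁ - k₂))
      = ((1 / 2) * inner ℝ k₁ (T k₁) + inner ℝ S k₁)
        - ((1 / 2) * inner ℝ k₂ (T k₂) + inner ℝ S k₂) := by
    have h1 : (inner ℝ k₁ (T k₂) : ℝ) = inner ℝ k₂ (T k₁) := by
      rw [← hsymm, real_inner_comm]
    have h2 : (inner ℝ (T k₂) k₁ : ℝ) = inner ℝ k₂ (T k₁) := hsymm _ _
    have h3 : (inner ℝ (T k₂) k₂ : ℝ) = inner ℝ k₂ (T k₂) := hsymm _ _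
    rw [hS, map_sub]
    simp only [inner_sub_left, inner_sub_right, inner_neg_left, h1, h2, h3]
    ring
  have h1 := hc (k₁ - k₂)
  have h2 := (abs_le.1 hr₁).1
  have h3 := (abs_le.1 hr₂).2
  have h4 : ‖k₁‖ ^ 2 ≤ 2 * ‖k₁ - k₂‖ ^ 2 + 2 * ‖k₂‖ ^ 2 := by
    have h5 : ‖k₁‖ ≤ ‖k₁ - k₂‖ + ‖k₂‖ := by simpa using norm_add_le (k₁ - k₂) k₂
    have h6 : ‖k₁‖ ^ 2 ≤ (‖k₁ - k₂‖ + ‖k₂‖) ^ 2 := pow_le_pow_left₀ (norm_nonneg _) h5 2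
    nlinarith [sq_nonneg (‖k₁ - k₂‖ - ‖k₂‖)]
  have h7 := mul_le_mul_of_nonneg_left h4 hε
  have h8 := mul_le_mul_of_nonneg_right hεc (sq_nonneg ‖k₁ - k₂‖)
  nlinarith

end Hessian

/-! ### Linearization of a single M-estimator -/

section Linearization

variable {𝒵 : Type*} [MeasurableSpace 𝒵] {μ : Measure 𝒵} {p : ℕ}

/-- The normalized score `n^{-1/2} ∑ᵢ g(zᵢ)`. -/
noncomputable def score {𝒳 : Type*} {p n : ℕ} (g : 𝒳 → EuclideanSpace ℝ (Fin p)) (z : Fin n → 𝒳) :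
    EuclideanSpace ℝ (Fin p) :=
  (√(n : ℝ))⁻¹ • ∑ i, g (z i)

lemma score_apply {n : ℕ} {g : 𝒵 → EuclideanSpace ℝ (Fin p)} (hg : Integrable g μ)
    (hg0 : ∫ z, g z ∂μ = 0) (z : Fin n → 𝒵) (a : Fin p) :
    score g z a = empFluct μ (fun x => g x a) z := by
  have h1 : ∫ x, g x a ∂μ = 0 := by
    have := (EuclideanSpace.proj a : EuclideanSpace ℝ (Fin p) →L[ℝ] ℝ).integral_comp_comm hg
    rw [hg0, map_zero] at this
    exact this
  simp [score, empFluct, h1]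

/-- The normalized score is bounded in probability, by Chebyshev's inequality. -/
lemma exists_score_tight [IsProbabilityMeasure μ] {g : 𝒵 → EuclideanSpace ℝ (Fin p)}
    (hg : MemLp g 2 μ) (hg0 : ∫ z, g z ∂μ = 0) {κ : ℝ} (hκ : 0 < κ) :
    ∃ A > 0, ∀ n : ℕ, (Measure.pi fun _ : Fin n => μ) {z | A < ‖score g z‖}
      ≤ ENNReal.ofReal κ := by
  have hga : ∀ a, MemLp (fun z => g z a) 2 μ := fun a =>
    hg.of_le ((EuclideanSpace.proj a :
      EuclideanSpace ℝ (Fin p) →L[ℝ] ℝ).continuous.comp_aestronglyMeasurable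
        hg.aestronglyMeasurable) (Eventually.of_forall fun z => PiLp.norm_apply_le (g z) a)
  set D : ℝ := ∑ a, ∫ z, g z a ^ 2 ∂μ with hD
  have hD0 : 0 ≤ D := Finset.sum_nonneg fun a _ => integral_nonneg fun z => sq_nonneg _
  set b : ℝ := √((D + 1) / κ) with hb
  have hbpos : 0 < b := Real.sqrt_pos.2 (by positivity)
  have hb2 : b ^ 2 = (D + 1) / κ := Real.sq_sqrt (by positivity)
  refine ⟨√p * b + 1, by positivity, fun n => ?_⟩
  set π := Measure.pi fun _ : Fin n => μ
  have hsub : {z : Fin n → 𝒵 | √p * b + 1 < ‖score g z‖}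
      ⊆ ⋃ a, {z | b ≤ |empFluct μ (fun x => g x a) z|} := by
    intro z hz
    by_contra hcon
    simp only [Set.mem_iUnion, Set.mem_ofPred_eq, not_exists, not_le] at hcon
    have h1 : ‖score g z‖ ≤ √p * b := by
      rw [EuclideanSpace.norm_eq]
      refine Real.sqrt_le_iff.2 ⟨by positivity, ?_⟩
      rw [mul_pow, Real.sq_sqrt (Nat.cast_nonneg p)]
      calc ∑ a, ‖score g z a‖ ^ 2 ≤ ∑ _a : Fin p, b ^ 2 := by
            refine Finset.sum_le_sum fun a _ => ?_
            rw [score_apply (hg.integrable (by norm_num)) hg0, Real.norm_eq_abs]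
            exact pow_le_pow_left₀ (abs_nonneg _) (hcon a).le 2
        _ = p * b ^ 2 := by simp
    rw [Set.mem_ofPred_eq] at hz
    linarith
  refine (measure_mono hsub).trans ((measure_iUnion_fintype_le _ _).trans ?_)
  refine (Finset.sum_le_sum fun a _ => empFluct_chebyshev (hga a) hbpos).trans ?_
  rw [← ENNReal.ofReal_sum_of_nonneg fun a _ =>
    div_nonneg (integral_nonneg fun z => sq_nonneg _) (sq_nonneg _), ← Finset.sum_div, ← hD, hb2]
  refine ENNReal.ofReal_le_ofReal ?_
  rw [div_div_eq_mul_div, div_le_iff₀ (by positivity)]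
  nlinarith

/-- The total loss increment is a quadratic in the local parameter `√n h`, up to the empirical
process of the remainder and the error of the expansion of its mean. -/
lemma sum_loss_sub_eq {f : 𝒵 → EuclideanSpace ℝ (Fin p) → ℝ} {g : 𝒵 → EuclideanSpace ℝ (Fin p)}
    {θ : EuclideanSpace ℝ (Fin p)} (T : EuclideanSpace ℝ (Fin p) →L[ℝ] EuclideanSpace ℝ (Fin p))
    {n : ℕ} (hn : 0 < n) (z : Fin n → 𝒵) (h : EuclideanSpace ℝ (Fin p)) :
    ∑ i, f (z i) (θ + h) - ∑ i, f (z i) θ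
      = (1 / 2) * inner ℝ (√(n : ℝ) • h) (T (√(n : ℝ) • h)) + inner ℝ (score g z) (√(n : ℝ) • h)
        + (√(n : ℝ) * empFluct μ (fun x => lossRemainder f g θ x h) z
          + n * (∫ x, lossRemainder f g θ x h ∂μ - (1 / 2) * inner ℝ h (T h))) := by
  have hn' : (0 : ℝ) < n := by exact_mod_cast hn
  have hsn : √(n : ℝ) ≠ 0 := (Real.sqrt_pos.2 hn').ne'
  have hsq : √(n : ℝ) * √(n : ℝ) = n := Real.mul_self_sqrt hn'.le
  have h1 : √(n : ℝ) * empFluct μ (fun x => lossRemainder f g θ x h) z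
      = ∑ i, f (z i) (θ + h) - ∑ i, f (z i) θ - ∑ i, inner ℝ (g (z i)) h
        - n * ∫ x, lossRemainder f g θ x h ∂μ := by
    rw [empFluct, mul_inv_cancel_left₀ hsn]
    simp only [lossRemainder, Finset.sum_sub_distrib, Finset.sum_const, Finset.card_univ,
      Fintype.card_fin, nsmul_eq_mul]
  have h2 : inner ℝ (score g z) (√(n : ℝ) • h) = ∑ i, inner ℝ (g (z i)) h := by
    rw [score, inner_smul_left, inner_smul_right, sum_inner, conj_trivial,
      inv_mul_cancel_left₀ hsn]
  have h3 : inner ℝ (√(n : ℝ) • h) (T (√(n : ℝ) • h)) = n * inner ℝ h (T h) := by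
    rw [map_smul, inner_smul_left, inner_smul_right, conj_trivial, ← mul_assoc, hsq]
  rw [h1, h2, h3]
  ring

variable [IsProbabilityMeasure μ] {Ω : Type*} [MeasurableSpace Ω] {P : Measure Ω}

/-- Linearization of an M-estimator: `√n (θ̂ - θ) = -T⁻¹ n^{-1/2} ∑ᵢ g(Xᵢ) + o_P(1)`. The estimator
is compared with the minimizer of the limiting quadratic. -/
theorem tendstoInMeasure_mEstimator_linearization
    {f : 𝒵 → EuclideanSpace ℝ (Fin p) → ℝ} {g : 𝒵 → EuclideanSpace ℝ (Fin p)}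
    {θ : EuclideanSpace ℝ (Fin p)} {r : ℝ} (hr : 0 < r)
    (hm : ∀ h, ‖h‖ ≤ r → Measurable fun z => f z (θ + h)) {L : 𝒵 → ℝ} (hLm : Measurable L)
    (hL0 : ∀ z, 0 ≤ L z) (hL : MemLp L 2 μ)
    (hlip : ∀ᵐ z ∂μ, ∀ h h', ‖h‖ ≤ r → ‖h'‖ ≤ r →
      |f z (θ + h) - f z (θ + h')| ≤ L z * ‖h - h'‖)
    (hg : Measurable g) (hgL : MemLp g 2 μ) (hg0 : ∫ z, g z ∂μ = 0)
    (hgrad : HasGradientAlongSubseqAt μ f g θ)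
    {T T' : EuclideanSpace ℝ (Fin p) →L[ℝ] EuclideanSpace ℝ (Fin p)}
    (hsymm : ∀ x y, inner ℝ (T x) y = (inner ℝ x (T y) : ℝ)) {c : ℝ} (hc0 : 0 < c)
    (hc : ∀ h, c * ‖h‖ ^ 2 ≤ inner ℝ h (T h)) (hT' : ∀ x, T (T' x) = x)
    (hexp : (fun h => ∫ z, lossRemainder f g θ z h ∂μ - (1 / 2) * inner ℝ h (T h))
      =o[𝓝 0] (fun h => ‖h‖ ^ 2))
    {Θ : Set (EuclideanSpace ℝ (Fin p))} (hΘ : ∀ h, ‖h‖ ≤ r → θ + h ∈ Θ)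
    {X : (n : ℕ) → Ω → Fin n → 𝒵} (hX : ∀ n, HasLaw (X n) (Measure.pi fun _ => μ) P)
    {θhat : ℕ → Ω → EuclideanSpace ℝ (Fin p)}
    (hmin : ∀ᶠ n in atTop, ∀ᵐ ω ∂P, IsMEstimate f Θ (X n ω) (θhat n ω))
    (hcons : TendstoInMeasure P θhat atTop (fun _ => θ)) :
    TendstoInMeasure P (fun (n : ℕ) ω => √(n : ℝ) • (θhat n ω - θ) + T' (score g (X n ω))) atTop
      (fun _ => 0) := by
  rw [tendstoInMeasure_iff_norm] at hcons ⊢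
  intro ε₀ hε₀
  suffices hκ : ∀ κ : ℝ, 0 < κ → ∀ᶠ n : ℕ in atTop,
      P {ω | ε₀ ≤ ‖√(n : ℝ) • (θhat n ω - θ) + T' (score g (X n ω)) - 0‖}
        ≤ ENNReal.ofReal (κ + κ + κ) by
    rw [ENNReal.tendsto_nhds_zero]
    intro e he
    rcases eq_or_ne e ⊤ with rfl | htop
    · simp
    · have hpos := ENNReal.toReal_pos he.ne' htop
      filter_upwards [hκ (e.toReal / 3) (by positivity)] with n hn
      refine hn.trans (le_of_eq ?_)
      rw [show e.toReal / 3 + e.toReal / 3 + e.toReal / 3 = e.toReal by ring,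
        ENNReal.ofReal_toReal htop]
  intro κ hκ
  obtain ⟨A, hA, htight⟩ := exists_score_tight hgL hg0 hκ
  set A' : ℝ := ‖T'‖ * A + 1 with hA'
  have hA'pos : 0 < A' := by positivity
  set ε : ℝ := min κ (min (c / 16) (c * ε₀ ^ 2 / (2 * (24 * A' ^ 2 + 8)))) with hε
  have hεpos : 0 < ε := by positivity
  have hεκ : ε ≤ κ := min_le_left _ _
  have hεc : 16 * ε ≤ c := by
    have : ε ≤ c / 16 := (min_le_right _ _).trans (min_le_left _ _)
    linarith
  have hεε₀ : ε * (24 * A' ^ 2 + 8) ≤ c * ε₀ ^ 2 / 2 := by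
    have : ε ≤ c * ε₀ ^ 2 / (2 * (24 * A' ^ 2 + 8)) := (min_le_right _ _).trans (min_le_right _ _)
    rw [le_div_iff₀ (by positivity)] at this
    linarith
  have hLg : MemLp (fun z => L z + ‖g z‖) 2 μ := hL.add hgL.norm
  obtain ⟨δ₁, hδ₁, hSD⟩ := stochastic_differentiability (μ := μ) (φ := lossRemainder f g θ) hr
    (fun h hh => (measurable_lossRemainder hr.le hg hm h hh).aestronglyMeasurable)
    lossRemainder_zero (hLm.add hg.norm) (fun z => add_nonneg (hL0 z) (norm_nonneg _)) hLg
    (lossRemainder_lipschitz hlip) (hgrad.isLittleO_integral_sq hr hg hm hL0 hLg hlip) hεpos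
  obtain ⟨δ₂, hδ₂, hEx⟩ := Metric.eventually_nhds_iff.1 (hexp.def hεpos)
  set δ : ℝ := min r (min δ₁ (δ₂ / 2)) with hδ
  have hδpos : 0 < δ := by positivity
  have hδr : δ ≤ r := min_le_left _ _
  have hδ1 : δ ≤ δ₁ := (min_le_right _ _).trans (min_le_left _ _)
  have hδ2 : δ ≤ δ₂ / 2 := (min_le_right _ _).trans (min_le_right _ _)
  have hcons' := (ENNReal.tendsto_nhds_zero.1 (hcons δ hδpos)) (ENNReal.ofReal κ)
    (ENNReal.ofReal_pos.2 hκ)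
  have hsqrt : ∀ᶠ n : ℕ in atTop, A' / δ ≤ √(n : ℝ) :=
    (Real.tendsto_sqrt_atTop.comp tendsto_natCast_atTop_atTop).eventually_ge_atTop _
  filter_upwards [hSD, hcons', hsqrt, hmin, eventually_gt_atTop 0] with n hn1 hn2 hn3 hn4 hn
  have hn' : (0 : ℝ) < n := by exact_mod_cast hn
  have hsn : 0 < √(n : ℝ) := Real.sqrt_pos.2 hn'
  have hsq : √(n : ℝ) * √(n : ℝ) = n := Real.mul_self_sqrt hn'.le
  set B₁ : Set (Fin n → 𝒵) := {z | A < ‖score g z‖} with hB₁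
  set B₂ : Set (Fin n → 𝒵) := {z | ∃ h, ‖h‖ ≤ δ₁ ∧
    ε * (√(n : ℝ) * ‖h‖ ^ 2 + 1 / √(n : ℝ))
      < |empFluct μ (fun x => lossRemainder f g θ x h) z|} with hB₂
  have hpre : ∀ B : Set (Fin n → 𝒵), P (X n ⁻¹' B) ≤ (Measure.pi fun _ : Fin n => μ) B := by
    intro B
    rw [← (hX n).map_eq]
    exact Measure.le_map_apply (hX n).aemeasurable B
  have hincl : ∀ᵐ ω ∂P, ω ∈ {ω | ε₀ ≤ ‖√(n : ℝ) • (θhat n ω - θ) + T' (score g (X n ω)) - 0‖} →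
      ω ∈ (X n ⁻¹' B₁ ∪ X n ⁻¹' B₂) ∪ {ω | δ ≤ ‖θhat n ω - θ‖} := by
    filter_upwards [hn4] with ω hω hbig
    by_contra hgood
    simp only [Set.mem_union, not_or, Set.mem_preimage, hB₁, hB₂, Set.mem_ofPred_eq, not_lt,
      not_le, not_exists, not_and] at hgood
    obtain ⟨⟨hg1, hg2⟩, hg3⟩ := hgood
    rw [sub_zero] at hbig
    set S := score g (X n ω) with hS
    set h₁ := θhat n ω - θ with hh₁
    set k₂ := -T' S with hk₂
    set h₂ := (√(n : ℝ))⁻¹ • k₂ with hh₂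
    have hk₂A : ‖k₂‖ ≤ A' := by
      rw [hk₂, norm_neg]
      refine (T'.le_opNorm S).trans ?_
      have := mul_le_mul_of_nonneg_left hg1 (norm_nonneg T')
      linarith
    have hk₂h : √(n : ℝ) • h₂ = k₂ := by rw [hh₂, smul_smul, mul_inv_cancel₀ hsn.ne', one_smul]
    have hh₂δ : ‖h₂‖ ≤ δ := by
      rw [hh₂, norm_smul, norm_inv, Real.norm_eq_abs, abs_of_pos hsn, inv_mul_le_iff₀ hsn]
      rw [div_le_iff₀ hδpos] at hn3
      linarith
    -- the perturbation of the quadratic at a point of the `δ`-ball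
    have hrem : ∀ h : EuclideanSpace ℝ (Fin p), ‖h‖ ≤ δ →
        |√(n : ℝ) * empFluct μ (fun x => lossRemainder f g θ x h) (X n ω)
          + n * (∫ x, lossRemainder f g θ x h ∂μ - (1 / 2) * inner ℝ h (T h))|
        ≤ ε * (2 * ‖√(n : ℝ) • h‖ ^ 2 + 1) := by
      intro h hh
      have e1 := hg2 h (hh.trans hδ1)
      have e2 : |∫ x, lossRemainder f g θ x h ∂μ - (1 / 2) * inner ℝ h (T h)| ≤ ε * ‖h‖ ^ 2 := by
        have hd : dist h 0 < δ₂ := by rw [dist_zero_right]; linarith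
        have := hEx hd
        rwa [Real.norm_eq_abs, Real.norm_eq_abs, abs_of_nonneg (sq_nonneg ‖h‖)] at this
      have e3 : ‖√(n : ℝ) • h‖ ^ 2 = n * ‖h‖ ^ 2 := by
        rw [norm_smul, Real.norm_eq_abs, abs_of_pos hsn, mul_pow, sq (√(n : ℝ)), hsq]
      refine (abs_add_le _ _).trans ?_
      rw [abs_mul, abs_mul, abs_of_pos hsn, abs_of_pos hn', e3]
      have e4 := mul_le_mul_of_nonneg_left e1 hsn.le
      have e5 := mul_le_mul_of_nonneg_left e2 hn'.le
      have e6 : √(n : ℝ) * (ε * (√(n : ℝ) * ‖h‖ ^ 2 + 1 / √(n : ℝ))) = ε * (n * ‖h‖ ^ 2 + 1) := by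
        have e7 : √(n : ℝ) * (1 / √(n : ℝ)) = 1 := mul_one_div_cancel hsn.ne'
        linear_combination ε * ‖h‖ ^ 2 * hsq + ε * e7
      linarith
    have hle : ∑ i, f (X n ω i) (θ + h₁) ≤ ∑ i, f (X n ω i) (θ + h₂) := by
      have h1 := hω.2 (hΘ h₂ (hh₂δ.trans hδr))
      simp only [empiricalRisk] at h1
      have h2 : θ + h₁ = θhat n ω := by rw [hh₁]; abel
      rw [h2]
      exact le_of_mul_le_mul_left h1 (by positivity)
    have e₁ := sum_loss_sub_eq (μ := μ) (f := f) (g := g) (θ := θ) T hn (X n ω) h₁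
    have e₂ := sum_loss_sub_eq (μ := μ) (f := f) (g := g) (θ := θ) T hn (X n ω) h₂
    have r₁ := hrem h₁ hg3.le
    have r₂ := hrem h₂ hh₂δ
    rw [hk₂h] at e₂ r₂
    have key := norm_sub_sq_le_of_perturbed_quadratic_le hsymm hc (S := S)
      (k₁ := √(n : ℝ) • h₁) (k₂ := k₂) (by rw [hk₂, map_neg, hT']) hεpos.le hεc r₁ r₂ (by linarith)
    rw [hk₂, sub_neg_eq_add] at key
    have h3 : ‖-T' S‖ ^ 2 ≤ A' ^ 2 := pow_le_pow_left₀ (norm_nonneg _) hk₂A 2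
    have h4 : ε₀ ^ 2 ≤ ‖√(n : ℝ) • h₁ + T' S‖ ^ 2 := pow_le_pow_left₀ hε₀.le hbig 2
    have h5 := mul_le_mul_of_nonneg_left h4 hc0.le
    have h6 := mul_le_mul_of_nonneg_left h3 hεpos.le
    have h7 : 0 < c * ε₀ ^ 2 := by positivity
    linarith
  refine (measure_mono_ae hincl).trans ((measure_union_le _ _).trans ?_)
  refine (add_le_add ((measure_union_le _ _).trans (add_le_add ((hpre B₁).trans (htight n))
    ((hpre B₂).trans (hn1.trans (ENNReal.ofReal_le_ofReal hεκ))))) hn2).trans ?_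
  rw [← ENNReal.ofReal_add hκ.le hκ.le, ← ENNReal.ofReal_add (by positivity) hκ.le]

end Linearization

/-! ### Random allocation of an i.i.d. sample -/

section Allocation

variable {𝒵 : Type*} [MeasurableSpace 𝒵] {μ : Measure 𝒵} [IsProbabilityMeasure μ]
  {Ω : Type*} [MeasurableSpace Ω] {P : Measure Ω} [IsProbabilityMeasure P]

lemma map_pi_comp_injective {n N : ℕ} {b : Fin n → Fin N} (hb : Function.Injective b) :
    (Measure.pi fun _ : Fin N => μ).map (fun z i => z (b i)) = Measure.pi fun _ : Fin n => μ := by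
  have h1 : iIndepFun (fun (i : Fin N) (z : Fin N → 𝒵) => z i) (Measure.pi fun _ => μ) :=
    iIndepFun_pi (X := fun _ x => x) fun _ => aemeasurable_id
  exact ((h1.precomp hb).hasLaw_pi fun i =>
    (measurePreserving_eval (fun _ : Fin N => μ) (b i)).hasLaw).map_eq

/-- A subsample of an i.i.d. sample that is selected without replacement, independently of the
observations, is again i.i.d. -/
lemma hasLaw_random_subsample {n N : ℕ} {Z : Fin N → Ω → 𝒵} (hZ : ∀ i, HasLaw (Z i) μ P)
    (hZi : iIndepFun Z P) {a : Ω → Fin n → Fin N} (ha : Measurable a)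
    (hinj : ∀ ω, Function.Injective (a ω)) (hind : IndepFun a (fun ω i => Z i ω) P) :
    HasLaw (fun ω i => Z (a ω i) ω) (Measure.pi fun _ : Fin n => μ) P := by
  set F : (Fin n → Fin N) × (Fin N → 𝒵) → Fin n → 𝒵 := fun x i => x.2 (x.1 i) with hF
  have hFm : Measurable F :=
    measurable_from_prod_countable_right fun b => measurable_pi_lambda _ fun i =>
      measurable_pi_apply (b i)
  have hZlaw := hZi.hasLaw_pi hZ
  have hpair := (indepFun_iff_hasLaw_prodMk_prod (HasLaw.mk (X := a) (P := P) (μ := P.map a)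
    ha.aemeasurable rfl) hZlaw).1 hind
  refine HasLaw.comp (Y := F) ⟨hFm.aemeasurable, ?_⟩ hpair
  have : IsProbabilityMeasure (P.map a) := Measure.isProbabilityMeasure_map ha.aemeasurable
  ext A hA
  rw [Measure.map_apply hFm hA, Measure.prod_apply (hFm hA)]
  have hae : ∀ᵐ b ∂(P.map a), (Measure.pi fun _ : Fin N => μ) (Prod.mk b ⁻¹' (F ⁻¹' A))
      = (Measure.pi fun _ : Fin n => μ) A := by
    refine (ae_map_iff ha.aemeasurable (Set.toFinite _).measurableSet).2
      (Eventually.of_forall fun ω => ?_)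
    rw [← map_pi_comp_injective (μ := μ) (hinj ω), Measure.map_apply (by fun_prop) hA]
    rfl
  rw [lintegral_congr_ae hae]
  simp

end Allocation

/-! ### The central limit theorem for triangular arrays of identical rows -/

section CLT

variable {𝒵 : Type*} [MeasurableSpace 𝒵] {μ : Measure 𝒵} [IsProbabilityMeasure μ]
  {Ω : Type*} [MeasurableSpace Ω] {P : Measure Ω} [IsProbabilityMeasure P] {p : ℕ}

lemma tendsto_charFun_pow_of_centered {X : 𝒵 → ℝ} (hX : MemLp X 2 μ) (h0 : ∫ z, X z ∂μ = 0) :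
    Tendsto (fun n : ℕ => charFun (μ.map X) (√(n : ℝ))⁻¹ ^ n) atTop
      (𝓝 (Complex.exp (-(((∫ z, X z ^ 2 ∂μ : ℝ) : ℂ) / 2)))) := by
  set v : ℝ := ∫ z, X z ^ 2 ∂μ with hv
  have hXm : AEMeasurable X μ := hX.aestronglyMeasurable.aemeasurable
  have hv0 : 0 ≤ v := integral_nonneg fun z => sq_nonneg _
  rcases hv0.eq_or_lt with hz | hpos
  · have hX0 : X =ᵐ[μ] fun _ => (0 : ℝ) := by
      have := (integral_eq_zero_iff_of_nonneg (fun z => sq_nonneg (X z)) hX.integrable_sq).1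
        hz.symm
      filter_upwards [this] with z hz
      simpa using hz
    have h1 : ∀ s : ℝ, charFun (μ.map X) s = 1 := by
      intro s
      rw [Measure.map_congr hX0, Measure.map_const, measure_univ, one_smul, charFun_dirac]
      simp
    simp [h1, ← hz]
  · have hs : 0 < √v := Real.sqrt_pos.2 hpos
    have hY := tendsto_charFun_inv_sqrt_mul_pow (P := μ) (X := fun z => (√v)⁻¹ * X z)
      (hXm.const_mul _) (by rw [integral_const_mul, h0, mul_zero]) (by
        simp only [Pi.pow_apply, mul_pow]
        rw [integral_const_mul, inv_pow, Real.sq_sqrt hv0]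
        exact inv_mul_cancel₀ hpos.ne') (√v)
    have e : ((√v : ℝ) : ℂ) ^ 2 = (v : ℂ) := by
      rw [← Complex.ofReal_pow, Real.sq_sqrt hv0]
    rw [e] at hY
    refine (hY.congr fun n => ?_).trans (le_of_eq (by rw [neg_div]))
    rw [charFun_map_mul_comp hXm]
    congr 2
    field_simp

/-- Multivariate central limit theorem for rows of `N n → ∞` i.i.d. observations, where no relation
between different rows is assumed. -/
theorem tendstoInDistribution_inv_sqrt_smul_sum {ξ : 𝒵 → EuclideanSpace ℝ (Fin p)}
    (hξ : Measurable ξ) (hξL : MemLp ξ 2 μ) (hξ0 : ∫ z, ξ z ∂μ = 0)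
    {C : Matrix (Fin p) (Fin p) ℝ} (hC : C.PosSemidef)
    (hcov : ∀ t : EuclideanSpace ℝ (Fin p), ∫ z, inner ℝ (ξ z) t ^ 2 ∂μ = t.ofLp ⬝ᵥ C *ᵥ t.ofLp)
    {N : ℕ → ℕ} (hN : Tendsto N atTop atTop) {Z : (n : ℕ) → Fin (N n) → Ω → 𝒵}
    (hZ : ∀ n i, HasLaw (Z n i) μ P) (hZi : ∀ n, iIndepFun (Z n) P) :
    TendstoInDistribution (fun (n : ℕ) (ω : Ω) => (√(N n : ℝ))⁻¹ • ∑ i, ξ (Z n i ω)) atTop id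
      (fun _ => P) (multivariateGaussian 0 C) where
  forall_aemeasurable n := by
    have hm : ∀ i, AEMeasurable (fun ω => ξ (Z n i ω)) P := fun i =>
      hξ.comp_aemeasurable (hZ n i).aemeasurable
    have h := Finset.aemeasurable_fun_sum Finset.univ fun i _ => hm i
    exact h.const_smul (√(N n : ℝ))⁻¹
  tendsto := by
    refine ProbabilityMeasure.tendsto_iff_tendsto_charFun.2 fun t => ?_
    simp only [ProbabilityMeasure.coe_mk, Measure.map_id]
    rw [charFun_multivariateGaussian hC]
    have hm : ∀ n i, AEMeasurable (fun ω => ξ (Z n i ω)) P := fun n i =>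
      hξ.comp_aemeasurable (hZ n i).aemeasurable
    have hone : ∀ n i, P.map (fun ω => ξ (Z n i ω)) = μ.map ξ := fun n i => by
      rw [← (hZ n i).map_eq, AEMeasurable.map_map_of_aemeasurable hξ.aemeasurable
        (hZ n i).aemeasurable]
      rfl
    have hinner : ∀ s : ℝ, charFun (μ.map ξ) (s • t)
        = charFun (μ.map fun z => inner ℝ (ξ z) t) s := by
      intro s
      rw [charFun_apply, charFun_apply_real, integral_map hξ.aemeasurable (by fun_prop),
        integral_map (hξ.inner_const).aemeasurable (by fun_prop)]
      simp [inner_smul_right]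
    have hchar : ∀ n, charFun (P.map fun ω => (√(N n : ℝ))⁻¹ • ∑ i, ξ (Z n i ω)) t
        = charFun (μ.map fun z => inner ℝ (ξ z) t) (√(N n : ℝ))⁻¹ ^ N n := by
      intro n
      have hind : iIndepFun (fun i ω => ξ (Z n i ω)) P := (hZi n).comp (fun _ => ξ) fun _ => hξ
      rw [charFun_map_smul_comp (Finset.aemeasurable_fun_sum _ fun i _ => hm n i),
        hind.charFun_map_fun_sum_eq_prod (hm n)]
      simp only [hone, Finset.prod_apply, Finset.prod_const, Finset.card_univ, Fintype.card_fin,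
        hinner]
    simp_rw [hchar]
    have hX : MemLp (fun z => inner ℝ (ξ z) t) 2 μ := hξL.inner_const t
    have h0 : ∫ z, inner ℝ (ξ z) t ∂μ = 0 := by
      have := integral_inner (𝕜 := ℝ) (hξL.integrable (by norm_num)) t
      rw [hξ0, inner_zero_right] at this
      rw [← this]
      congr 1; ext z; exact real_inner_comm _ _
    have := (tendsto_charFun_pow_of_centered hX h0).comp hN
    rw [hcov] at this
    simpa [Function.comp_def] using this

end CLT

/-! ### The sandwich covariance -/

section Covariance

variable {𝒵 : Type*} [MeasurableSpace 𝒵] {μ : Measure 𝒵} {p : ℕ}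
  {g : 𝒵 → EuclideanSpace ℝ (Fin p)}

lemma memLp_coord (hg : MemLp g 2 μ) (a : Fin p) : MemLp (fun z => g z a) 2 μ :=
  hg.of_le ((EuclideanSpace.proj a :
    EuclideanSpace ℝ (Fin p) →L[ℝ] ℝ).continuous.comp_aestronglyMeasurable
      hg.aestronglyMeasurable) (Eventually.of_forall fun z => PiLp.norm_apply_le (g z) a)

lemma integrable_coord_mul (hg : MemLp g 2 μ) (a b : Fin p) :
    Integrable (fun z => g z a * g z b) μ :=
  (memLp_coord hg a).integrable_mul (memLp_coord hg b)

lemma integral_inner_sq (hg : MemLp g 2 μ) (u : EuclideanSpace ℝ (Fin p)) :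
    ∫ z, inner ℝ (g z) u ^ 2 ∂μ = u.ofLp ⬝ᵥ secondMomentMatrix μ g *ᵥ u.ofLp := by
  have e : ∀ z, inner ℝ (g z) u ^ 2 = ∑ a, ∑ b, u a * u b * (g z a * g z b) := by
    intro z
    rw [PiLp.inner_apply, sq, Finset.sum_mul_sum]
    refine Finset.sum_congr rfl fun a _ => Finset.sum_congr rfl fun b _ => ?_
    simp only [RCLike.inner_apply, conj_trivial]
    ring
  have hI : ∀ a b, Integrable (fun z => u a * u b * (g z a * g z b)) μ := fun a b =>
    (integrable_coord_mul hg a b).const_mul _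
  simp_rw [e]
  rw [integral_finsetSum _ fun a _ => integrable_finsetSum _ fun b _ => hI a b]
  simp only [dotProduct, Matrix.mulVec, Finset.mul_sum]
  refine Finset.sum_congr rfl fun a _ => ?_
  rw [integral_finsetSum _ fun b _ => hI a b]
  refine Finset.sum_congr rfl fun b _ => ?_
  rw [integral_const_mul]
  simp only [secondMomentMatrix, Matrix.of_apply]
  ring

lemma isSymm_secondMomentMatrix : (secondMomentMatrix μ g).IsSymm := by
  ext a b
  simp [secondMomentMatrix, mul_comm]

/-- The quadratic form of the sandwich covariance is the variance of a linear image of `g`. -/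
lemma integral_inner_toEuclideanCLM_sq (hg : MemLp g 2 μ) {W : Matrix (Fin p) (Fin p) ℝ}
    (hW : W.IsSymm) (t : EuclideanSpace ℝ (Fin p)) :
    ∫ z, inner ℝ (g z) (Matrix.toEuclideanCLM (𝕜 := ℝ) W t) ^ 2 ∂μ
      = t.ofLp ⬝ᵥ (W * secondMomentMatrix μ g * W) *ᵥ t.ofLp := by
  rw [integral_inner_sq hg, Matrix.ofLp_toEuclideanCLM, ← Matrix.mulVec_mulVec,
    ← Matrix.mulVec_mulVec, Matrix.dotProduct_mulVec t.ofLp W, ← Matrix.mulVec_transpose, hW.eq]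

lemma posSemidef_sandwich (hg : MemLp g 2 μ) {W : Matrix (Fin p) (Fin p) ℝ} (hW : W.IsSymm) :
    (W * secondMomentMatrix μ g * W).PosSemidef := by
  refine Matrix.PosSemidef.of_dotProduct_mulVec_nonneg ?_ fun x => ?_
  · rw [Matrix.IsHermitian, Matrix.conjTranspose_eq_transpose_of_trivial, Matrix.transpose_mul,
      Matrix.transpose_mul, hW.eq, isSymm_secondMomentMatrix.eq, Matrix.mul_assoc]
  · have := integral_inner_toEuclideanCLM_sq hg hW (WithLp.toLp 2 x)
    simp only [star_trivial]
    rw [← this]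
    exact integral_nonneg fun z => sq_nonneg _

lemma inner_toEuclideanCLM_left {W : Matrix (Fin p) (Fin p) ℝ} (hW : W.IsSymm)
    (x y : EuclideanSpace ℝ (Fin p)) :
    (inner ℝ (Matrix.toEuclideanCLM (𝕜 := ℝ) W x) y : ℝ)
      = inner ℝ x (Matrix.toEuclideanCLM (𝕜 := ℝ) W y) := by
  rw [real_inner_comm, Matrix.inner_toEuclideanCLM, Matrix.inner_toEuclideanCLM,
    Matrix.dotProduct_mulVec, ← Matrix.mulVec_transpose, hW.eq, dotProduct_comm]

end Covariance

/-! ### Averaging over the machines -/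

section Averaging

variable {Ω : Type*} [MeasurableSpace Ω] {P : Measure Ω} {p m : ℕ}

lemma tendstoInMeasure_const_smul_sum {D : ℕ → Fin m → Ω → EuclideanSpace ℝ (Fin p)} (c : ℝ)
    (hD : ∀ j, TendstoInMeasure P (fun n => D n j) atTop (fun _ => 0)) :
    TendstoInMeasure P (fun n ω => c • ∑ j, D n j ω) atTop (fun _ => 0) := by
  simp only [tendstoInMeasure_iff_norm, sub_zero] at hD ⊢
  intro ε hε
  set κ : ℝ := ε / ((|c| + 1) * (m + 1)) with hκ
  have hκpos : 0 < κ := by positivity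
  have hsum : Tendsto (fun n => ∑ j, P {ω | κ ≤ ‖D n j ω‖}) atTop (𝓝 0) := by
    have := tendsto_finsetSum Finset.univ fun j _ => hD j κ hκpos
    simpa using this
  refine tendsto_of_tendsto_of_tendsto_of_le_of_le tendsto_const_nhds hsum (fun _ => zero_le) ?_
  intro n
  refine le_trans (measure_mono fun ω hω => ?_) (measure_iUnion_fintype_le _ _)
  by_contra hcon
  simp only [Set.mem_iUnion, Set.mem_ofPred_eq, not_exists, not_le] at hcon
  rw [Set.mem_ofPred_eq, norm_smul, Real.norm_eq_abs] at hω
  have h1 : ‖∑ j, D n j ω‖ ≤ m * κ := by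
    refine (norm_sum_le _ _).trans ((Finset.sum_le_sum fun j _ => (hcon j).le).trans ?_)
    simp
  have h2 : (|c| + 1) * ((m + 1) * κ) = ε := by rw [hκ]; field_simp
  have h3 : |c| * ‖∑ j, D n j ω‖ ≤ |c| * (m * κ) := by gcongr
  nlinarith [mul_nonneg (abs_nonneg c) hκpos.le, mul_nonneg (Nat.cast_nonneg (α := ℝ) m) hκpos.le]

/-- The normalized error of the average, in terms of the machine-wise linearization errors and of
the score of the full sample. -/
lemma sqrt_smul_machineAverage_sub {𝒳 : Type*} {n : ℕ} (hm : 0 < m) (hn : 0 < n)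
    (g : 𝒳 → EuclideanSpace ℝ (Fin p)) (z : Fin (m * n) → 𝒳) {a : Fin m × Fin n → Fin (m * n)}
    (ha : Function.Bijective a) (θhat : Fin m → EuclideanSpace ℝ (Fin p))
    (θ : EuclideanSpace ℝ (Fin p))
    (W : EuclideanSpace ℝ (Fin p) →L[ℝ] EuclideanSpace ℝ (Fin p)) :
    √((m * n : ℕ) : ℝ) • (machineAverage θhat - θ)
        - (√((m * n : ℕ) : ℝ))⁻¹ • ∑ i, -W (g (z i))
      = (√(m : ℝ))⁻¹ • ∑ j, (√(n : ℝ) • (θhat j - θ) + W (score g fun i => z (a (j, i)))) := by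
  have hm' : (0 : ℝ) < m := by exact_mod_cast hm
  have hn' : (0 : ℝ) < n := by exact_mod_cast hn
  have hsm : 0 < √(m : ℝ) := Real.sqrt_pos.2 hm'
  have hsn : 0 < √(n : ℝ) := Real.sqrt_pos.2 hn'
  have hN : √((m * n : ℕ) : ℝ) = √(m : ℝ) * √(n : ℝ) := by
    rw [Nat.cast_mul, Real.sqrt_mul hm'.le]
  have hmm : √(m : ℝ) * √(m : ℝ) = m := Real.mul_self_sqrt hm'.le
  have h1 : ∑ i, W (g (z i)) = ∑ j, ∑ i, W (g (z (a (j, i)))) := by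
    rw [← Fintype.sum_prod_type']
    exact (Function.Bijective.sum_comp ha fun k => W (g (z k))).symm
  have h2 : machineAverage θhat - θ = (m : ℝ)⁻¹ • ∑ j, (θhat j - θ) := by
    rw [machineAverage, Finset.sum_sub_distrib, smul_sub, Finset.sum_const, Finset.card_univ,
      Fintype.card_fin, ← Nat.cast_smul_eq_nsmul ℝ, smul_smul, inv_mul_cancel₀ hm'.ne', one_smul,
      one_div]
  have h3 : ∀ j, W (score g fun i => z (a (j, i)))
      = (√(n : ℝ))⁻¹ • ∑ i, W (g (z (a (j, i)))) := by
    intro j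
    rw [score, map_smul, map_sum]
  rw [h2, Finset.sum_neg_distrib, h1, hN, Finset.sum_add_distrib, ← Finset.smul_sum, smul_neg,
    sub_neg_eq_add, smul_add, smul_smul, smul_smul]
  simp only [h3]
  rw [← Finset.smul_sum, smul_smul, mul_inv]
  congr 2
  have hinv : (m : ℝ)⁻¹ = (√(m : ℝ))⁻¹ * (√(m : ℝ))⁻¹ := by rw [← mul_inv, hmm]
  rw [hinv]
  field_simp

end Averaging

/-! ### Convergence in distribution on a one-point space -/

section OnePoint

lemma measure_eq_of_subsingleton {E : Type*} [MeasurableSpace E] [Subsingleton E]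
    (ν ν' : Measure E) [IsProbabilityMeasure ν] [IsProbabilityMeasure ν'] : ν = ν' := by
  ext s -
  rcases s.eq_empty_or_nonempty with rfl | hs
  · simp
  · rw [Subsingleton.eq_univ_of_nonempty hs, measure_univ, measure_univ]

lemma tendstoInDistribution_of_subsingleton {Ω : Type*} [MeasurableSpace Ω] {P : Measure Ω}
    [IsProbabilityMeasure P] {E : Type*} [MeasurableSpace E] [TopologicalSpace E]
    [OpensMeasurableSpace E] [Subsingleton E] {ν : Measure E} [IsProbabilityMeasure ν]
    (X : ℕ → Ω → E) (hX : ∀ n, AEMeasurable (X n) P) :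
    TendstoInDistribution X atTop id (fun _ => P) ν := by
  have hprob : ∀ n, IsProbabilityMeasure (P.map (X n)) := fun n =>
    Measure.isProbabilityMeasure_map (hX n)
  refine tendstoInDistribution_of_identDistrib 0
    (fun j => ⟨hX 0, hX j, measure_eq_of_subsingleton _ _⟩) ⟨hX 0, aemeasurable_id, ?_⟩
  rw [Measure.map_id]
  exact measure_eq_of_subsingleton _ _

end OnePoint

/-! ### The population minimizer -/

section PopulationMinimizer

variable {𝒵 : Type*} [MeasurableSpace 𝒵] {μ : Measure 𝒵} [IsProbabilityMeasure μ] {p : ℕ}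
  {f : 𝒵 → EuclideanSpace ℝ (Fin p) → ℝ} {g : 𝒵 → EuclideanSpace ℝ (Fin p)}
  {θ : EuclideanSpace ℝ (Fin p)}

/-- At a population minimizer the gradient is centered, the Hessian of the risk is positive
semidefinite, and the mean of the first order remainder is the quadratic form of the Hessian. -/
lemma HasSecondOrderTaylorAt.integral_lossRemainder {r : ℝ} (hr : 0 < r)
    (hm : ∀ h, ‖h‖ ≤ r → Measurable fun z => f z (θ + h))
    (hnn : ∀ h, ‖h‖ ≤ r → ∀ z, 0 ≤ f z (θ + h)) {L : 𝒵 → ℝ} (hL0 : ∀ z, 0 ≤ L z)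
    (hL : MemLp L 2 μ)
    (hlip : ∀ᵐ z ∂μ, ∀ h h', ‖h‖ ≤ r → ‖h'‖ ≤ r →
      |f z (θ + h) - f z (θ + h')| ≤ L z * ‖h - h'‖)
    (hg : Measurable g) (hgL : MemLp g 2 μ) (hgrad : HasGradientAlongSubseqAt μ f g θ)
    (hfin : populationRisk μ f θ ≠ ⊤)
    (hmin : ∀ h, ‖h‖ ≤ r → populationRisk μ f θ ≤ populationRisk μ f (θ + h))
    {V : Matrix (Fin p) (Fin p) ℝ}
    (hT : HasSecondOrderTaylorAt (fun θ => (populationRisk μ f θ).toReal) V θ) :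
    ∫ z, g z ∂μ = 0 ∧ V.PosSemidef ∧
    (fun h => ∫ z, lossRemainder f g θ z h ∂μ
        - (1 / 2) * inner ℝ h (Matrix.toEuclideanCLM (𝕜 := ℝ) V h))
      =o[𝓝 0] (fun h => ‖h‖ ^ 2) := by
  set R : EuclideanSpace ℝ (Fin p) → ℝ := fun θ => (populationRisk μ f θ).toReal with hR
  have hball : ∀ᶠ h : EuclideanSpace ℝ (Fin p) in 𝓝 0, ‖h‖ ≤ r := by
    filter_upwards [Metric.closedBall_mem_nhds (0 : EuclideanSpace ℝ (Fin p)) hr] with h hh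
    simpa using hh
  have hgI : Integrable g μ := hgL.integrable (by norm_num)
  have hsub := fun h (hh : ‖h‖ ≤ r) => populationRisk_toReal_sub hr.le hfin hm hnn
    (hL.integrable (by norm_num)) hlip hh
  have hrem : ∀ h, ‖h‖ ≤ r →
      ∫ z, lossRemainder f g θ z h ∂μ = R (θ + h) - R θ - inner ℝ (∫ z, g z ∂μ) h := by
    intro h hh
    obtain ⟨-, hI, heq⟩ := hsub h hh
    have hin : ∫ z, inner ℝ (g z) h ∂μ = inner ℝ (∫ z, g z ∂μ) h := by
      rw [real_inner_comm, ← integral_inner hgI]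
      congr 1; ext z; exact real_inner_comm _ _
    simp only [lossRemainder]
    rw [integral_sub hI (hgI.inner_const h), hin, ← heq]
  have hLmin : ∀ᶠ h in 𝓝 0, R θ ≤ R (θ + h) := by
    filter_upwards [hball] with h hh
    exact ENNReal.toReal_mono (hsub h hh).1 (hmin h hh)
  have hLg : MemLp (fun z => L z + ‖g z‖) 2 μ := hL.add hgL.norm
  have hsq := hgrad.isLittleO_integral_sq hr hg hm hL0 hLg hlip
  have hfirst : (fun h => R (θ + h) - R θ - inner ℝ (∫ z, g z ∂μ) h) =o[𝓝 0] fun h => h := by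
    refine IsLittleO.of_bound fun c hc => ?_
    filter_upwards [hsq.def (pow_pos hc 2), hball] with h h1 hh
    rw [← hrem h hh, Real.norm_eq_abs]
    have hφ : MemLp (fun z => lossRemainder f g θ z h) 2 μ := by
      refine (hLg.mul_const ‖h‖).of_le
        (measurable_lossRemainder hr.le hg hm h hh).aestronglyMeasurable ?_
      filter_upwards [lossRemainder_lipschitz (g := g) hlip] with z hz
      have h2 := hz h 0 hh (by simpa using hr.le)
      rw [lossRemainder_zero, sub_zero, sub_zero] at h2
      exact h2.trans (le_abs_self _)
    -- Jensen's inequality, in the form of nonnegativity of the variance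
    have hvar := variance_nonneg (fun z => lossRemainder f g θ z h) μ
    rw [variance_eq_sub hφ] at hvar
    simp only [Pi.pow_apply] at hvar
    rw [Real.norm_eq_abs, Real.norm_eq_abs, abs_of_nonneg (sq_nonneg ‖h‖)] at h1
    refine abs_le_of_sq_le_sq ?_ (by positivity)
    rw [mul_pow]
    linarith [le_abs_self (∫ z, lossRemainder f g θ z h ^ 2 ∂μ)]
  obtain ⟨hexp, hzero⟩ := hT.of_isLocalMin hLmin
  have hg0 : ∫ z, g z ∂μ = 0 := hzero _ hfirst
  refine ⟨hg0, posSemidef_of_isLocalMin hT.1 hexp hLmin, hexp.congr' ?_ EventuallyEq.rfl⟩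
  filter_upwards [hball] with h hh
  rw [hrem h hh, hg0, inner_zero_left, sub_zero]

end PopulationMinimizer

/-! ### Asymptotic normality -/

theorem mainTheorem2
    {𝒵 : Type*} [MeasurableSpace 𝒵] (μ : Measure 𝒵) [IsProbabilityMeasure μ]
    {Ω : Type*} [MeasurableSpace Ω] (P : Measure Ω) [IsProbabilityMeasure P]
    (p m : ℕ) (hm : 0 < m)
    -- the parameter space, the loss and the population minimizer
    (Θ : Set (EuclideanSpace ℝ (Fin p))) (hΘ_open : IsOpen Θ) (hΘ_convex : Convex ℝ Θ)
    (f : 𝒵 → EuclideanSpace ℝ (Fin p) → ℝ)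
    (hf_meas : ∀ θ ∈ Θ, Measurable fun z => f z θ)
    (hf_nonneg : ∀ z, ∀ θ ∈ Θ, 0 ≤ f z θ)
    (θstar : EuclideanSpace ℝ (Fin p)) (hθstar : θstar ∈ Θ)
    (hθstar_min : ∀ θ ∈ Θ, θ ≠ θstar → populationRisk μ f θstar < populationRisk μ f θ)
    -- for every `n`, the `N = m * n` i.i.d. observations
    (Z : (n : ℕ) → Fin (m * n) → Ω → 𝒵)
    (hZ_law : ∀ n i, HasLaw (Z n i) μ P)
    (hZ_indep : ∀ n, iIndepFun (Z n) P)
    -- their random allocation: `alloc n ω (j, i)` is the index of the `i`-th observation that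
    -- machine `j` receives
    (alloc : (n : ℕ) → Ω → Fin m × Fin n → Fin (m * n))
    (halloc_meas : ∀ n, Measurable (alloc n))
    (halloc_bij : ∀ n ω, Function.Bijective (alloc n ω))
    (halloc_indep : ∀ n, IndepFun (alloc n) (fun ω i => Z n i ω) P)
    -- the machine-wise M-estimators
    (θhat : (n : ℕ) → Fin m → Ω → EuclideanSpace ℝ (Fin p))
    (hθhat_meas : ∀ n j, AEMeasurable (θhat n j) P)
    (hθhat_min : ∀ᶠ n in atTop, ∀ j, ∀ᵐ ω ∂P,
      IsMEstimate f Θ (fun i => Z n (alloc n ω (j, i)) ω) (θhat n j ω))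
    -- consistency
    (hA1 : ∀ j, TendstoInMeasure P (fun n => θhat n j) atTop (fun _ => θstar))
    -- second order expansion of the population risk, with nonsingular Hessian
    (V : Matrix (Fin p) (Fin p) ℝ)
    (hA2 : HasSecondOrderTaylorAt (fun θ => (populationRisk μ f θ).toReal) V θstar)
    (hV : IsUnit V.det)
    -- differentiability of the loss, almost surely or in probability, with gradient `g`
    (g : 𝒵 → EuclideanSpace ℝ (Fin p))
    (hA3 : (∀ᵐ z ∂μ, HasGradientAt (f z) (g z) θstar) ∨ HasGradientInProbabilityAt μ f g θstar)
    -- local Lipschitz condition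
    (hA4 : IsLipschitzNear μ f θstar) :
    -- the limiting covariance matrix is well defined
    (∀ a b, Integrable (fun z => g z a * g z b) μ) ∧
    (V⁻¹ * secondMomentMatrix μ g * V⁻¹).PosSemidef ∧
    -- `√N (θbar - θstar)` converges in distribution to the Gaussian law with that covariance
    TendstoInDistribution
      (fun (n : ℕ) (ω : Ω) =>
        √((m * n : ℕ) : ℝ) • (machineAverage (fun j => θhat n j ω) - θstar))
      atTop id (fun _ => P)
      (multivariateGaussian 0 (V⁻¹ * secondMomentMatrix μ g * V⁻¹)) := by
  -- for `p = 0` the risk may be infinite at `θstar`, so this case cannot go through the expansion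
  rcases Nat.eq_zero_or_pos p with rfl | hp
  · refine ⟨fun a => a.elim0, ?_, tendstoInDistribution_of_subsingleton _ fun n => ?_⟩
    · rw [Subsingleton.elim (V⁻¹ * secondMomentMatrix μ g * V⁻¹) 0]
      exact Matrix.PosSemidef.zero
    · exact (measurable_of_subsingleton_codomain _).aemeasurable
  obtain ⟨M, hM, U, hU, hlipU⟩ := hA4
  obtain ⟨r, hr, hrΘU⟩ : ∃ r > 0, ∀ h, ‖h‖ ≤ r → θstar + h ∈ Θ ∩ U := by
    obtain ⟨s, hs, hball⟩ := Metric.mem_nhds_iff.1 (inter_mem (hΘ_open.mem_nhds hθstar) hU)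
    refine ⟨s / 2, by positivity, fun h hh => hball ?_⟩
    rw [mem_ball_iff_norm, add_sub_cancel_left]
    linarith
  -- a measurable and nonnegative version of the Lipschitz constant
  have hMae := hM.aestronglyMeasurable.aemeasurable
  set L : 𝒵 → ℝ := fun z => |hMae.mk M z| with hLdef
  have hLm : Measurable L := hMae.measurable_mk.abs
  have hL0 : ∀ z, 0 ≤ L z := fun z => abs_nonneg _
  have hL : MemLp L 2 μ := (hM.ae_eq hMae.ae_eq_mk).abs
  have hlip : ∀ᵐ z ∂μ, ∀ h h', ‖h‖ ≤ r → ‖h'‖ ≤ r →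
      |f z (θstar + h) - f z (θstar + h')| ≤ L z * ‖h - h'‖ := by
    filter_upwards [hlipU, hMae.ae_eq_mk] with z hz hMz h h' hh hh'
    have h1 := hz _ (hrΘU h hh).2 _ (hrΘU h' hh').2
    rw [add_sub_add_left_eq_sub] at h1
    refine h1.trans (mul_le_mul_of_nonneg_right ?_ (norm_nonneg _))
    rw [hMz]
    exact le_abs_self _
  have hm' : ∀ h, ‖h‖ ≤ r → Measurable fun z => f z (θstar + h) := fun h hh =>
    hf_meas _ (hrΘU h hh).1
  have hnn : ∀ h, ‖h‖ ≤ r → ∀ z, 0 ≤ f z (θstar + h) := fun h hh z => hf_nonneg z _ (hrΘU h hh).1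
  have hgrad₀ : HasGradientAlongSubseqAt μ f g θstar :=
    hA3.elim hasGradientAlongSubseqAt_of_ae fun h => h.alongSubseq
  -- replace the gradient by a measurable version
  have hgm := hgrad₀.aemeasurable hr hm'
  set g' := hgm.mk g with hg'def
  have hg' : Measurable g' := hgm.measurable_mk
  have hgg' : g =ᵐ[μ] g' := hgm.ae_eq_mk
  have hgrad := hgrad₀.congr hgg'
  have hgL : MemLp g' 2 μ := by
    refine (hL.const_mul √p).of_le hg'.aestronglyMeasurable ?_
    filter_upwards [hgrad.norm_le hr hL0 hlip] with z hz
    exact hz.trans (le_abs_self _)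
  have hS : secondMomentMatrix μ g = secondMomentMatrix μ g' := by
    ext a b
    refine integral_congr_ae ?_
    filter_upwards [hgg'] with z hz
    rw [hz]
  have hsymm : V⁻¹.IsSymm := by
    rw [Matrix.IsSymm, Matrix.transpose_nonsing_inv, hA2.1.eq]
  have hminRisk : ∀ h, ‖h‖ ≤ r → populationRisk μ f θstar ≤ populationRisk μ f (θstar + h) := by
    intro h hh
    rcases eq_or_ne (θstar + h) θstar with heq | hne
    · rw [heq]
    · exact (hθstar_min _ (hrΘU h hh).1 hne).le
  -- since `p > 0`, `Θ` has a point other than `θstar`, where the risk is strictly larger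
  have hfin : populationRisk μ f θstar ≠ ⊤ := by
    set e : EuclideanSpace ℝ (Fin p) := r • EuclideanSpace.single ⟨0, hp⟩ 1 with he
    have hne : ‖e‖ = r := by
      rw [he, norm_smul, PiLp.norm_single, norm_one, mul_one, Real.norm_eq_abs, abs_of_pos hr]
    refine (lt_of_lt_of_le (hθstar_min (θstar + e) (hrΘU e hne.le).1 ?_) le_top).ne
    intro heq
    rw [add_eq_left.1 heq, norm_zero] at hne
    exact hr.ne hne
  obtain ⟨hg0, hVpsd, hexp⟩ := hA2.integral_lossRemainder hr hm' hnn hL0 hL hlip hg' hgL hgrad hfin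
    hminRisk
  have hVpd : V.PosDef := hVpsd.posDef_iff_isUnit.2 ((Matrix.isUnit_iff_isUnit_det V).2 hV)
  obtain ⟨c, hc0, hc⟩ := exists_pos_forall_mul_norm_sq_le hVpd
  set T := Matrix.toEuclideanCLM (𝕜 := ℝ) V with hT
  set W := Matrix.toEuclideanCLM (𝕜 := ℝ) V⁻¹ with hW
  have hTW : ∀ x, T (W x) = x := by
    intro x
    have : T * W = 1 := by rw [hT, hW, ← map_mul, Matrix.mul_nonsing_inv V hV, map_one]
    exact congrArg (fun A : EuclideanSpace ℝ (Fin p) →L[ℝ] EuclideanSpace ℝ (Fin p) => A x) this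
  -- each machine holds an i.i.d. sample because the allocation is independent of the data
  have hlin : ∀ j, TendstoInMeasure P (fun (n : ℕ) ω => √(n : ℝ) • (θhat n j ω - θstar)
      + W (score g' fun i => Z n (alloc n ω (j, i)) ω)) atTop (fun _ => 0) := by
    intro j
    refine tendstoInMeasure_mEstimator_linearization (μ := μ) hr hm' hLm hL0 hL hlip hg' hgL hg0
      hgrad (inner_toEuclideanCLM_left hA2.1) hc0 hc hTW hexp (fun h hh => (hrΘU h hh).1)
      (X := fun n ω i => Z n (alloc n ω (j, i)) ω) (fun n => ?_)
      (hθhat_min.mono fun n hn => hn j) (hA1 j)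
    have hsel : Measurable fun (b : Fin m × Fin n → Fin (m * n)) (i : Fin n) => b (j, i) :=
      measurable_pi_lambda _ fun i => measurable_pi_apply _
    refine hasLaw_random_subsample (hZ_law n) (hZ_indep n)
      (a := fun ω i => alloc n ω (j, i)) (hsel.comp (halloc_meas n)) (fun ω i i' hii' => ?_)
      ((halloc_indep n).comp hsel measurable_id)
    simpa using (halloc_bij n ω).1 hii'
  have hsandwich : (V⁻¹ * secondMomentMatrix μ g' * V⁻¹).PosSemidef := posSemidef_sandwich hgL hsymm
  rw [hS]
  refine ⟨fun a b => (integrable_coord_mul hgL a b).congr ?_, hsandwich, ?_⟩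
  · filter_upwards [hgg'] with z hz
    rw [hz]
  -- the average of the linearizations is a normalized sum over the whole sample, to which the
  -- central limit theorem applies
  have hξL : MemLp (fun z => -W (g' z)) 2 μ := (W.comp_memLp' hgL).neg
  have hclt := tendstoInDistribution_inv_sqrt_smul_sum (P := P) (ξ := fun z => -W (g' z))
    (W.continuous.measurable.comp hg').neg hξL
    (by
      rw [integral_neg, W.integral_comp_comm (hgL.integrable (by norm_num)), hg0, map_zero,
        neg_zero])
    hsandwich
    (fun t => by
      rw [← integral_inner_toEuclideanCLM_sq hgL hsymm]
      congr 1; ext z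
      rw [inner_neg_left, neg_sq, hW, inner_toEuclideanCLM_left hsymm])
    (N := fun n => m * n) (tendsto_id.const_mul_atTop' hm) hZ_law hZ_indep
  refine tendstoInDistribution_of_tendstoInMeasure_sub _ _ hclt ?_ fun n => ?_
  · have hsum := tendstoInMeasure_const_smul_sum (√(m : ℝ))⁻¹ hlin
    rw [tendstoInMeasure_iff_norm] at hsum ⊢
    intro ε hε
    refine (hsum ε hε).congr' ?_
    filter_upwards [eventually_gt_atTop 0] with n hn
    congr 1
    ext ω
    simp only [Set.mem_ofPred_eq, Pi.sub_apply, Pi.zero_apply]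
    rw [sqrt_smul_machineAverage_sub hm hn g' (fun i => Z n i ω) (halloc_bij n ω)]
  · have hsumm := Finset.aemeasurable_fun_sum (μ := P) Finset.univ fun j _ => hθhat_meas n j
    have havg : AEMeasurable (fun ω => machineAverage fun j => θhat n j ω) P :=
      hsumm.const_smul (1 / (m : ℝ))
    exact (havg.sub_const θstar).const_smul (√((m * n : ℕ) : ℝ))
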